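/- **Model.** An algorithm is a straight-line program over $\mathbb R$: a finite list of instructions, each of which stores a real constant, or the sum, difference, product or quotient of two registers; every instruction costs one step, and a division by zero is not allowed on the inputs for which the program is claimed to work. The inputs and outputs of a program are vectors of reals. A matrix $A\in\mathbb R^{n\times n}$ has a matrix-vector product algorithm with $t$ steps if some program with at most $t$ steps outputs $As$ for every input $s\in\mathbb R^n$. A symmetric matrix $L\in\mathbb R^{n\times n}$ has eigenvector basis $X$ with eigenvalues $\mu\in\mathbb R^n$ if $X$ is orthogonal and $L=X\,\mathrm{diag}(\mu)\,X^\top$. **Theorem.** Let $U_n\in\mathbb R^{n\times n}$ $(n\ge 0)$ be matrices and $f:\mathbb N\to[0,\infty)$, and assume that $U_n$ has a matrix-vector product algorithm with $O(f(n))$ steps as $n\to\infty$. 1. There are programs $Q_n$ with $O(n\log^2 n+f(n))$ steps, depending only on $n$ (and the given sequence $(U_n)$), with the following property. Let $\tilde L\in\mathbb R^{n\times n}$ have eigenvector basis $U_n$ with pairwise distinct eigenvalues $\lambda$, let $\rho\in\mathbb R\setminus\{0\}$ and $v\in\mathbb R^n$ be such that $z=U_n^\top v$ has no zero entry, and let $X$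 be any eigenvector basis of $\tilde L+\rho vv^\top$, with eigenvalues $\mu$. Then $\lambda_i\neq\mu_j$ for all $i,j$, and there is $a\in\mathbb R^n$ with $$X=U_n\,\mathrm{diag}(z)\,C(\lambda,\mu)\,\mathrm{diag}(a),\qquad C(\lambda,\mu)_{ij}=\frac1{\lambda_i-\mu_j},$$ such that $Q_n$, on the inputs $s,\lambda,\mu,z,a$, outputs $Xs$, for every $s\in\mathbb R^n$. 2. There is $t(n)=O(n\log^2 n+f(n))$ such that for every $n$, every $\tilde L\in\mathbb R^{n\times n}$ with eigenvector basis $U_n$ and eigenvalues $\lambda$ (repetitions allowed), every $\rho\in\mathbb R$ and every $v\in\mathbb R^n$: some eigenvector basis of $\tilde L+\rho vv^\top$ has a matrix-vector product algorithm with $t(n)$ steps; and if the eigenvalues of $\tilde L$ are pairwise distinct, or those of $\tilde L+\rho vv^\top$ are, then every eigenvector basis of $\tilde L+\rho vv^\top$ has one. -/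

import Mathlib

/-! ### Algorithms over the real numbers: straight-line programs, one step per instruction -/

/-- An instruction of a straight-line program over `ℝ`. Registers are either read-only input
registers, labelled by `ι`, or work registers, labelled by `ℕ`. Each instruction stores one real
number in the work register `d`: a constant, or the sum, difference, product or quotient of the
contents of the registers `i` and `j`. -/
inductive RInstr (ι : Type) : Type
  | const (d : ℕ) (c : ℝ) : RInstr ι
  | add (d : ℕ) (i j : ι ⊕ ℕ) : RInstr ι
  | sub (d : ℕ) (i j : ι ⊕ ℕ) : RInstr ι
  | mul (d : ℕ) (i j : ι ⊕ ℕ) : RInstr ι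
  | div (d : ℕ) (i j : ι ⊕ ℕ) : RInstr ι

/-- The contents of register `i`, for inputs `x` and work memory `r`. -/
def regVal {ι : Type} (x : ι → ℝ) (r : ℕ → ℝ) (i : ι ⊕ ℕ) : ℝ := Sum.elim x r i

open Classical in
/-- Execution of one instruction on inputs `x` and work memory `r`. A division by zero aborts the
computation (value `none`). -/
noncomputable def RInstr.exec {ι : Type} (x : ι → ℝ) (r : ℕ → ℝ) : RInstr ι → Option (ℕ → ℝ)
  | .const d c => some (Function.update r d c)
  | .add d i j => some (Function.update r d (regVal x r i + regVal x r j))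
  | .sub d i j => some (Function.update r d (regVal x r i - regVal x r j))
  | .mul d i j => some (Function.update r d (regVal x r i * regVal x r j))
  | .div d i j =>
      if regVal x r j = 0 then none
      else some (Function.update r d (regVal x r i / regVal x r j))

/-- Execution of a list of instructions, from left to right. -/
noncomputable def runCode {ι : Type} (x : ι → ℝ) : List (RInstr ι) → (ℕ → ℝ) → Option (ℕ → ℝ)
  | [], r => some r
  | c :: cs, r => (c.exec x r).bind (runCode x cs)

/-- A straight-line program with inputs labelled by `ι` and outputs labelled by `κ`: a list of
instructions, and for each output the register in which it is found at the end. -/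
structure RProgram (ι κ : Type) : Type where
  code : List (RInstr ι)
  out : κ → ι ⊕ ℕ

/-- The running time: every instruction counts as one step. -/
def RProgram.steps {ι κ : Type} (P : RProgram ι κ) : ℕ := P.code.length

/-- On the inputs `x` the program, started with empty work memory, meets no division by zero and
outputs `y`. -/
def RProgram.Outputs {ι κ : Type} (P : RProgram ι κ) (x : ι → ℝ) (y : κ → ℝ) : Prop :=
  ∃ r : ℕ → ℝ, runCode x P.code (fun _ => 0) = some r ∧ ∀ k, regVal x r (P.out k) = y k

/-- The matrix `A` has a matrix-vector product algorithm with at most `t` steps: a program that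
computes `A s` for every input vector `s`. -/
def HasMatVecProgram {n : ℕ} (A : Matrix (Fin n) (Fin n) ℝ) (t : ℕ) : Prop :=
  ∃ P : RProgram (Fin n) (Fin n), P.steps ≤ t ∧ ∀ s : Fin n → ℝ, P.Outputs s (A.mulVec s)

/-! ### Eigenvector bases, rank-one updates, Cauchy matrices -/

/-- `L = X diag(μ) Xᵀ` with `X` orthogonal: the columns of `X` are an orthonormal eigenvector
basis of the symmetric matrix `L`, with eigenvalues `μ`. -/
def IsEigenbasis {n : ℕ} (L X : Matrix (Fin n) (Fin n) ℝ) (μ : Fin n → ℝ) : Prop :=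
  X ∈ Matrix.orthogonalGroup (Fin n) ℝ ∧ L = X * Matrix.diagonal μ * X.transpose

/-- The symmetric rank-one update `L + ρ v vᵀ`. -/
def rankOneUpdate {n : ℕ} (L : Matrix (Fin n) (Fin n) ℝ) (v : Fin n → ℝ) (ρ : ℝ) :
    Matrix (Fin n) (Fin n) ℝ :=
  L + ρ • Matrix.vecMulVec v v

/-- The Cauchy matrix with entries `1 / (α i - β j)` (meant for `α`, `β` without common
entries). -/
noncomputable def cauchyMatrix {n : ℕ} (α β : Fin n → ℝ) : Matrix (Fin n) (Fin n) ℝ :=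
  Matrix.of fun i j => 1 / (α i - β j)

/-! ### Inputs of the updated transform -/

/-- The five input vectors of an algorithm for the updated transform: the signal, and the
quantities available from the setup stage. -/
inductive InputVec : Type
  | signal | oldEig | newEig | weight | scale

/-- The five input vectors, as inputs of a program. -/
def packInputs {n : ℕ} (s lam mu z a : Fin n → ℝ) : InputVec × Fin n → ℝ
  | (.signal, i) => s i
  | (.oldEig, i) => lam i
  | (.newEig, i) => mu i
  | (.weight, i) => z i
  | (.scale, i) => a i

/-! Conjugation by `U n` reduces everything to `diagonal lam + ρ z zᵀ`. The eigenvector equation of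
that matrix reads, entry by entry, `(lam i - mu j) * Y i j = z i * a j` with `a j = -ρ ⟨z, Y_j⟩`
(`IsEigenbasis.entry`). If no `lam i` equals a `mu j`, then `Y` is a Cauchy matrix scaled on both
sides, and the theorem rests on multiplying a Cauchy matrix by a vector in `O(n log² n)` operations
(`Comp.cauchy`). For that, `∑ j, w j / (x - β j)` is combined into one fraction `u / v` by divide
and conquer, and `u`, `v` are evaluated at all nodes (`Comp.multiEval`). Both rest on real
polynomial multiplication in `O(n log n)` operations (`Comp.polyMul`), obtained from Bruun's
factorization, which needs no complex roots of unity.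

Degenerate updates: at a coincidence `lam i = mu j` one has `z i * a j = 0`, so the offending
parameters can be moved away without changing the scaled Cauchy matrix, and the entries at
coincidences form a correction with at most `n` entries when either spectrum is simple
(`IsEigenbasis.fastMul`). With repeated eigenvalues, Householder reflections inside the eigenspaces
first concentrate `z` in one coordinate per eigenvalue (`exists_householder`). The coordinates with
weight zero are then given distinct large eigenvalues, which leaves the eigenvectors usable
(`exists_fastMul_of_injOn`).

Costs are counted by `Comp` in a commutative real algebra. Taking functions on a set `D` of inputs
as the algebra yields one program valid on all of `D` (`Comp.exists_program`); there a unit is a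
function without zeros, so divisions are safe. -/

/-! ### Straight-line computations in a commutative real algebra -/

section Computation

variable {R : Type*} [CommRing R] [Algebra ℝ R]

/-- `RingOp A f`: the element `f` is a real constant, or the result of one arithmetic operation on
elements of `A`. -/
inductive RingOp (A : Set R) : R → Prop
  | const (c : ℝ) : RingOp A (algebraMap ℝ R c)
  | add {a b : R} (ha : a ∈ A) (hb : b ∈ A) : RingOp A (a + b)
  | sub {a b : R} (ha : a ∈ A) (hb : b ∈ A) : RingOp A (a - b)
  | mul {a b : R} (ha : a ∈ A) (hb : b ∈ A) : RingOp A (a * b)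
  | div {a b c : R} (ha : a ∈ A) (hb : b ∈ A) (hu : IsUnit b) (h : c * b = a) : RingOp A c

/-- `Comp A t B`: starting from the elements of `A`, all elements of `B` can be obtained with at
most `t` arithmetic operations. -/
inductive Comp : Set R → ℕ → Set R → Prop
  | done {A B : Set R} {t : ℕ} (h : B ⊆ A) : Comp A t B
  | step {A B : Set R} {t : ℕ} {f : R} (hf : RingOp A f) (h : Comp (insert f A) t B) :
      Comp A (t + 1) B

theorem RingOp.mono {A A' : Set R} (hA : A ⊆ A') {f : R} (h : RingOp A f) : RingOp A' f := by
  cases h with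
  | const c => exact .const c
  | add ha hb => exact .add (hA ha) (hA hb)
  | sub ha hb => exact .sub (hA ha) (hA hb)
  | mul ha hb => exact .mul (hA ha) (hA hb)
  | div ha hb hu h => exact .div (hA ha) (hA hb) hu h

theorem Comp.mono {A A' B B' : Set R} {t t' : ℕ} (h : Comp A t B) (hA : A ⊆ A') (hB : B' ⊆ B)
    (ht : t ≤ t') : Comp A' t' B' := by
  induction h generalizing A' t' with
  | done h => exact .done (hB.trans (h.trans hA))
  | step hf h ih =>
    obtain ⟨t', rfl⟩ : ∃ k, t' = k + 1 := ⟨t' - 1, by omega⟩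
    exact .step (hf.mono hA) (ih (Set.insert_subset_insert hA) hB (by omega))

theorem Comp.steps_le {A B : Set R} {t t' : ℕ} (h : Comp A t B) (ht : t ≤ t') : Comp A t' B :=
  h.mono subset_rfl subset_rfl ht

theorem Comp.mono_left {A A' B : Set R} {t : ℕ} (h : Comp A t B) (hA : A ⊆ A') : Comp A' t B :=
  h.mono hA subset_rfl le_rfl

theorem Comp.mono_right {A B B' : Set R} {t : ℕ} (h : Comp A t B) (hB : B' ⊆ B) : Comp A t B' :=
  h.mono subset_rfl hB le_rfl

theorem Comp.bind {A B C : Set R} {s t : ℕ} (h : Comp A s B) (h' : Comp (A ∪ B) t C) :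
    Comp A (s + t) C := by
  induction h with
  | done h => exact h'.mono (by simp [h]) subset_rfl (by omega)
  | @step A B s f hf h ih =>
    rw [show s + 1 + t = s + t + 1 by ring]
    exact .step hf (ih (h'.mono_left (Set.union_subset_union_left _ (Set.subset_insert _ _))))

theorem Comp.bind_keep {A B C : Set R} {s t : ℕ} (h : Comp A s B) (h' : Comp (A ∪ B) t C) :
    Comp A (s + t) (B ∪ C) := by
  induction h with
  | @done A B s h =>
    have h2 : Comp A t C := h'.mono (by simp [h]) subset_rfl le_rfl
    clear h'
    refine Comp.steps_le ?_ (Nat.le_add_left _ _)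
    induction h2 with
    | done h1 => exact .done (Set.union_subset h h1)
    | step hf _ ih => exact .step hf (ih (h.trans (Set.subset_insert _ _)))
  | @step A B s f hf h ih =>
    rw [show s + 1 + t = s + t + 1 by ring]
    exact .step hf (ih (h'.mono_left (Set.union_subset_union_left _ (Set.subset_insert _ _))))

theorem Comp.trans {A B C : Set R} {s t : ℕ} (h : Comp A s B) (h' : Comp B t C) :
    Comp A (s + t) C :=
  h.bind (h'.mono_left Set.subset_union_right)

theorem Comp.union {A B C : Set R} {s t : ℕ} (h : Comp A s B) (h' : Comp A t C) :
    Comp A (s + t) (B ∪ C) :=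
  h.bind_keep (h'.mono_left Set.subset_union_left)

theorem Comp.of_op {A : Set R} {f : R} (h : RingOp A f) : Comp A 1 {f} :=
  .step h (.done (by simp))

theorem Comp.const (A : Set R) (c : ℝ) : Comp A 1 {algebraMap ℝ R c} := .of_op (.const c)

theorem Comp.zero (A : Set R) : Comp A 1 {(0 : R)} := by
  simpa using Comp.const A 0

theorem Comp.one (A : Set R) : Comp A 1 {(1 : R)} := by
  simpa using Comp.const A 1

theorem Comp.of_mem {A : Set R} {a : R} (h : a ∈ A) : Comp A 0 {a} := .done (by simpa)

theorem Comp.add {A : Set R} {a b : R} {s t : ℕ} (ha : Comp A s {a}) (hb : Comp A t {b}) :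
    Comp A (s + t + 1) {a + b} :=
  (ha.union hb).trans (.of_op (.add (by simp) (by simp)))

theorem Comp.sub {A : Set R} {a b : R} {s t : ℕ} (ha : Comp A s {a}) (hb : Comp A t {b}) :
    Comp A (s + t + 1) {a - b} :=
  (ha.union hb).trans (.of_op (.sub (by simp) (by simp)))

theorem Comp.mul {A : Set R} {a b : R} {s t : ℕ} (ha : Comp A s {a}) (hb : Comp A t {b}) :
    Comp A (s + t + 1) {a * b} :=
  (ha.union hb).trans (.of_op (.mul (by simp) (by simp)))

theorem Comp.biUnion {ι : Type*} {A : Set R} {t : ℕ} {B : ι → Set R} (I : Finset ι)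
    (h : ∀ i ∈ I, Comp A t (B i)) : Comp A (I.card * t) (⋃ i ∈ I, B i) := by
  classical
  induction I using Finset.induction_on with
  | empty => exact .done (by simp)
  | insert i I hi ih =>
    rw [Finset.card_insert_of_notMem hi, Finset.set_biUnion_insert, add_mul, one_mul, add_comm]
    exact (h i (by simp)).union (ih fun j hj => h j (by simp [hj]))

theorem Comp.range {n : ℕ} {A : Set R} {t : ℕ} {v : Fin n → R}
    (h : ∀ i, Comp A t {v i}) : Comp A (n * t) (Set.range v) := by
  have := Comp.biUnion (B := fun i => {v i}) Finset.univ (fun i _ => h i)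
  rw [Finset.card_univ, Fintype.card_fin] at this
  exact this.mono_right (by rintro _ ⟨i, rfl⟩; simp)

end Computation

/-! ### Computations and programs -/

/-- A computation whose inputs are found in registers is carried out by a program, for all inputs
in `D` at once. -/
theorem Comp.exists_code {ι : Type} {D : Type} (x : D → ι → ℝ) {A B : Set (D → ℝ)} {t : ℕ}
    (h : Comp A t B) (k : ℕ) (r : D → ℕ → ℝ)
    (hA : ∀ f ∈ A, ∃ i : ι ⊕ ℕ, (∀ l, i = .inr l → l < k) ∧ ∀ d, regVal (x d) (r d) i = f d) :
    ∃ (code : List (RInstr ι)) (r' : D → ℕ → ℝ), code.length ≤ t ∧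
      (∀ d, runCode (x d) code (r d) = some (r' d)) ∧
      ∀ f ∈ B, ∃ i : ι ⊕ ℕ, ∀ d, regVal (x d) (r' d) i = f d := by
  induction h generalizing k r with
  | done h =>
    refine ⟨[], r, by simp, fun d => rfl, fun f hf => ?_⟩
    obtain ⟨i, -, hi⟩ := hA f (h hf)
    exact ⟨i, hi⟩
  | @step A B t f hf h ih =>
    -- Register `k` is fresh: every known element sits in an input register or in a work register
    -- below `k`, so writing to `k` destroys nothing.
    have key : ∃ c : RInstr ι, ∀ d, c.exec (x d) (r d) = some (Function.update (r d) k (f d)) := by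
      cases hf with
      | const c => exact ⟨.const k c, fun d => rfl⟩
      | @add a b ha hb =>
        obtain ⟨i, -, hi⟩ := hA a ha
        obtain ⟨j, -, hj⟩ := hA b hb
        exact ⟨.add k i j, fun d => by simp [RInstr.exec, hi, hj]⟩
      | @sub a b ha hb =>
        obtain ⟨i, -, hi⟩ := hA a ha
        obtain ⟨j, -, hj⟩ := hA b hb
        exact ⟨.sub k i j, fun d => by simp [RInstr.exec, hi, hj]⟩
      | @mul a b ha hb =>
        obtain ⟨i, -, hi⟩ := hA a ha
        obtain ⟨j, -, hj⟩ := hA b hb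
        exact ⟨.mul k i j, fun d => by simp [RInstr.exec, hi, hj]⟩
      | @div a b c ha hb hu h =>
        obtain ⟨i, -, hi⟩ := hA a ha
        obtain ⟨j, -, hj⟩ := hA b hb
        refine ⟨.div k i j, fun d => ?_⟩
        have hb0 : b d ≠ 0 := by
          rw [Pi.isUnit_iff] at hu
          exact (hu d).ne_zero
        have : f d = a d / b d := by rw [← h]; simp [hb0]
        simp [RInstr.exec, hi, hj, hb0, this]
    obtain ⟨c, hc⟩ := key
    obtain ⟨code, r', hlen, hrun, hout⟩ := ih (k + 1) (fun d => Function.update (r d) k (f d)) (by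
      intro g hg
      rcases hg with rfl | hg
      · exact ⟨.inr k, fun l hl => by cases hl; omega, fun d => by simp [regVal]⟩
      · obtain ⟨i, hik, hi⟩ := hA g hg
        refine ⟨i, fun l hl => (hik l hl).trans (Nat.lt_succ_self k), fun d => ?_⟩
        rw [← hi d]
        cases i with
        | inl i => rfl
        | inr l => simp [regVal, Function.update_of_ne (hik l rfl).ne])
    refine ⟨c :: code, r', by simpa using hlen, fun d => ?_, hout⟩
    simp [runCode, hc, hrun]

theorem Comp.exists_program {ι κ : Type} {D : Type} (x : D → ι → ℝ) {t : ℕ} {y : κ → D → ℝ}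
    (h : Comp (Set.range fun i d => x d i) t (Set.range y)) :
    ∃ P : RProgram ι κ, P.steps ≤ t ∧ ∀ d, P.Outputs (x d) (fun k => y k d) := by
  obtain ⟨code, r', hlen, hrun, hout⟩ := h.exists_code x 0 (fun _ _ => 0) (by
    rintro _ ⟨i, rfl⟩
    exact ⟨.inl i, by simp, fun d => rfl⟩)
  choose o ho using fun k => hout (y k) ⟨k, rfl⟩
  exact ⟨⟨code, o⟩, hlen, fun d => ⟨r' d, hrun d, fun k => ho k d⟩⟩

/-- Converse of `Comp.exists_code`: a given program can be run inside a larger computation, on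
intermediate results `y`. That the run succeeds for every `d` is what makes each divisor a unit. -/
theorem Comp.of_runCode {ι D : Type} (y : D → ι → ℝ) (code : List (RInstr ι)) (A : Set (D → ℝ))
    (r r' : D → ℕ → ℝ) (hA : ∀ i : ι ⊕ ℕ, (fun d => regVal (y d) (r d) i) ∈ A)
    (hrun : ∀ d, runCode (y d) code (r d) = some (r' d)) :
    Comp A code.length (Set.range fun (i : ι ⊕ ℕ) d => regVal (y d) (r' d) i) := by
  induction code generalizing A r with
  | nil =>
    obtain rfl : r = r' := funext fun d => by simpa [runCode] using hrun d
    exact .done (by rintro _ ⟨i, rfl⟩; exact hA i)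
  | cons c code ih =>
    have key : ∃ (f : D → ℝ) (k : ℕ), RingOp A f ∧
        ∀ d, c.exec (y d) (r d) = some (Function.update (r d) k (f d)) := by
      cases c with
      | const k c => exact ⟨_, k, .const c, fun d => rfl⟩
      | add k i j => exact ⟨_, k, .add (hA i) (hA j), fun d => rfl⟩
      | sub k i j => exact ⟨_, k, .sub (hA i) (hA j), fun d => rfl⟩
      | mul k i j => exact ⟨_, k, .mul (hA i) (hA j), fun d => rfl⟩
      | div k i j =>
        have h0 : ∀ d, regVal (y d) (r d) j ≠ 0 := fun d h0 => by
          have := hrun d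
          simp [runCode, RInstr.exec, h0] at this
        refine ⟨fun d => regVal (y d) (r d) i / regVal (y d) (r d) j, k,
          .div (hA i) (hA j) (Pi.isUnit_iff.2 fun d => (h0 d).isUnit) ?_, fun d => ?_⟩
        · ext d; simp [h0 d]
        · simp [RInstr.exec, h0 d]
    obtain ⟨f, k, hf, hc⟩ := key
    refine .step hf (ih _ (fun d => Function.update (r d) k (f d)) (fun i => ?_) fun d => ?_)
    · cases i with
      | inl i => exact Or.inr (hA (.inl i))
      | inr l =>
        by_cases hl : l = k
        · subst hl; left; ext d; simp [regVal]
        · right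
          convert hA (.inr l) using 2
          simp [regVal, Function.update_of_ne hl]
    · simpa [runCode, hc d] using hrun d

/-- `FastMul A t`: the product of `A` with a vector of functions takes at most `t` operations. -/
def FastMul {n : ℕ} (A : Matrix (Fin n) (Fin n) ℝ) (t : ℕ) : Prop :=
  ∀ (D : Type) (s : Fin n → D → ℝ),
    Comp (Set.range s) t (Set.range fun i d => A.mulVec (fun j => s j d) i)

theorem HasMatVecProgram.fastMul {n : ℕ} {A : Matrix (Fin n) (Fin n) ℝ} {t : ℕ}
    (h : HasMatVecProgram A t) : FastMul A (t + 1) := by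
  intro D s
  obtain ⟨P, hP, hout⟩ := h
  choose r hr hrk using fun d => hout fun j => s j d
  -- The program may read work registers it has never written. They contain 0, and the one extra
  -- step provides this constant.
  have := Comp.of_runCode (fun d j => s j d) P.code (Set.range s ∪ {0}) (fun _ _ => 0) r (by
    rintro (i | l)
    · exact Or.inl ⟨i, rfl⟩
    · exact Or.inr rfl) hr
  refine ((Comp.zero (Set.range s)).bind this).mono subset_rfl ?_ (by
    rw [add_comm]; exact Nat.add_le_add_right hP 1)
  rintro _ ⟨i, rfl⟩
  exact ⟨P.out i, funext fun d => hrk d i⟩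

theorem FastMul.hasMatVecProgram {n : ℕ} {A : Matrix (Fin n) (Fin n) ℝ} {t : ℕ}
    (h : FastMul A t) : HasMatVecProgram A t := by
  obtain ⟨P, hP, hout⟩ := Comp.exists_program (κ := Fin n) (fun s : Fin n → ℝ => s)
    (h (Fin n → ℝ) fun j s => s j)
  exact ⟨P, hP, fun s => hout s⟩

/-! ### Sums, products and sparse matrices -/

theorem FastMul.mono {n : ℕ} {A : Matrix (Fin n) (Fin n) ℝ} {s t : ℕ} (h : FastMul A s)
    (hst : s ≤ t) : FastMul A t := fun D x => (h D x).steps_le hst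

theorem FastMul.mul {n : ℕ} {A B : Matrix (Fin n) (Fin n) ℝ} {s t : ℕ}
    (hA : FastMul A s) (hB : FastMul B t) : FastMul (A * B) (t + s) := by
  intro D x
  refine ((hB D x).trans (hA D _)).mono_right ?_
  rintro _ ⟨i, rfl⟩
  exact ⟨i, by simp [← Matrix.mulVec_mulVec]⟩

theorem FastMul.add {n : ℕ} {A B : Matrix (Fin n) (Fin n) ℝ} {s t : ℕ}
    (hA : FastMul A s) (hB : FastMul B t) : FastMul (A + B) (s + t + n) := by
  intro D x
  refine ((hA D x).union (hB D x)).trans ?_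
  have := Comp.range (n := n) (t := 1)
    (v := fun i d => A.mulVec (fun j => x j d) i + B.mulVec (fun j => x j d) i)
    (A := (Set.range fun i d => A.mulVec (fun j => x j d) i) ∪
      (Set.range fun i d => B.mulVec (fun j => x j d) i))
    fun i => .of_op (.add (Or.inl ⟨i, rfl⟩) (Or.inr ⟨i, rfl⟩))
  rw [mul_one] at this
  refine this.mono_right ?_
  rintro _ ⟨i, rfl⟩
  exact ⟨i, by simp [Matrix.add_mulVec]⟩

/-- Entries of `P` are added one at a time. Each changes a single partial sum and costs three
operations: load the entry, multiply, add. The leading 1 creates the zero with which all sums start.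
-/
theorem FastMul.of_sparse {n : ℕ} (A : Matrix (Fin n) (Fin n) ℝ) (P : Finset (Fin n × Fin n))
    (hP : ∀ i j, A i j ≠ 0 → (i, j) ∈ P) : FastMul A (1 + 3 * P.card) := by
  intro D s
  have key : ∀ P : Finset (Fin n × Fin n), Comp (Set.range s) (1 + 3 * P.card)
      (Set.range fun i d => ∑ p ∈ P, if p.1 = i then A p.1 p.2 * s p.2 d else 0) := by
    intro P
    induction P using Finset.induction_on with
    | empty =>
      refine (Comp.zero _).mono_right ?_
      rintro _ ⟨i, rfl⟩
      simp; rfl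
    | insert p P hp ih =>
      rw [Finset.card_insert_of_notMem hp, show 1 + 3 * (P.card + 1) = 1 + 3 * P.card + 3 by ring]
      refine ih.bind ?_
      have h := (Comp.of_mem (A := Set.range s ∪ Set.range fun i d =>
        ∑ p ∈ P, if p.1 = i then A p.1 p.2 * s p.2 d else 0) (Or.inr ⟨p.1, rfl⟩)).add
        ((Comp.const _ (A p.1 p.2)).mul (Comp.of_mem (Or.inl ⟨p.2, rfl⟩)))
      have h2 := h.union (.done (t := 0) Set.subset_union_right)
      refine h2.mono_right ?_
      rintro _ ⟨i, rfl⟩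
      by_cases hi : p.1 = i
      · left
        subst hi
        ext d
        simp [Finset.sum_insert hp, add_comm]
      · right
        exact ⟨i, by simp [Finset.sum_insert hp, hi]⟩
  refine (key P).mono_right ?_
  rintro _ ⟨i, rfl⟩
  refine ⟨i, funext fun d => ?_⟩
  simp only [Matrix.mulVec, dotProduct]
  rw [← Finset.sum_filter]
  have : (Finset.univ.filter fun j => (i, j) ∈ P).map ⟨fun j => (i, j), Prod.mk_right_injective i⟩
      = P.filter fun p => p.1 = i := by
    ext ⟨a, b⟩; simp; grind
  rw [← this, Finset.sum_map, Finset.sum_filter]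
  refine Finset.sum_congr rfl fun j _ => ?_
  by_cases h : (i, j) ∈ P
  · simp [h]
  · have : A i j = 0 := by by_contra h0; exact h (hP i j h0)
    simp [h, this]

/-! ### Fast multiplication of real polynomials -/

section FastPolynomial

open Polynomial

variable {R : Type*} [CommRing R]

/-- The set of coefficients of a polynomial, including `0`. -/
def coeffSet (p : R[X]) : Set R := Set.range p.coeff

theorem coeff_mem_coeffSet (p : R[X]) (i : ℕ) : p.coeff i ∈ coeffSet p := ⟨i, rfl⟩

theorem zero_mem_coeffSet (p : R[X]) : (0 : R) ∈ coeffSet p :=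
  ⟨p.natDegree + 1, coeff_eq_zero_of_natDegree_lt (Nat.lt_succ_self _)⟩

theorem coeff_zero_of_degree_lt {p : R[X]} {m i : ℕ} (h : p.degree < m) (hi : m ≤ i) :
    p.coeff i = 0 := (degree_lt_iff_coeff_zero p m).1 h i hi

/-- The polynomial with coefficients `h 0, …, h (m - 1)`. -/
noncomputable def ofSeq (m : ℕ) (h : ℕ → R) : R[X] := ∑ i ∈ Finset.range m, monomial i (h i)

theorem coeff_ofSeq (m : ℕ) (h : ℕ → R) (i : ℕ) :
    (ofSeq m h).coeff i = if i < m then h i else 0 := by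
  simp [ofSeq, coeff_monomial]

theorem degree_ofSeq_lt (m : ℕ) (h : ℕ → R) : (ofSeq m h).degree < m := by
  rw [degree_lt_iff_coeff_zero]
  intro i hi
  simp [coeff_ofSeq, hi.not_gt]

theorem coeffSet_ofSeq_subset (m : ℕ) (h : ℕ → R) :
    coeffSet (ofSeq m h) ⊆ {0} ∪ h '' Set.Iio m := by
  rintro _ ⟨i, rfl⟩
  rw [coeff_ofSeq]
  split_ifs with hi
  · exact Or.inr ⟨i, hi, rfl⟩
  · exact Or.inl rfl

/-- Cutting a polynomial into blocks only regroups coefficients, hence costs no operations; the same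
holds for `coeffSet_join_subset`. -/
theorem exists_split {p : R[X]} (m l : ℕ) (hp : p.degree < (m + l : ℕ)) :
    ∃ p₀ p₁ : R[X], p = p₀ + X ^ m * p₁ ∧ p₀.degree < m ∧ p₁.degree < l ∧
      coeffSet p₀ ⊆ coeffSet p ∧ coeffSet p₁ ⊆ coeffSet p := by
  refine ⟨ofSeq m p.coeff, ofSeq l fun i => p.coeff (m + i), ?_, degree_ofSeq_lt _ _,
    degree_ofSeq_lt _ _, ?_, ?_⟩
  · ext i
    rw [coeff_add, coeff_X_pow_mul', coeff_ofSeq, coeff_ofSeq]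
    by_cases h : i < m
    · simp [h, h.not_ge]
    · push Not at h
      by_cases h2 : i - m < l
      · simp [h, h.not_gt, h2]
      · simp [h, h.not_gt, h2, coeff_zero_of_degree_lt hp (show m + l ≤ i by omega)]
  all_goals
    refine (coeffSet_ofSeq_subset _ _).trans (Set.union_subset ?_ ?_)
    · simpa using zero_mem_coeffSet p
    · rintro _ ⟨i, -, rfl⟩
      exact coeff_mem_coeffSet _ _

theorem coeffSet_join_subset {p₀ : R[X]} {m : ℕ} (h : p₀.degree < m) (p₁ : R[X]) :
    coeffSet (p₀ + X ^ m * p₁) ⊆ coeffSet p₀ ∪ coeffSet p₁ := by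
  rintro _ ⟨i, rfl⟩
  rw [coeff_add, coeff_X_pow_mul']
  split_ifs with hi
  · rw [coeff_zero_of_degree_lt h hi, zero_add]
    exact Or.inr (coeff_mem_coeffSet _ _)
  · rw [add_zero]
    exact Or.inl (coeff_mem_coeffSet _ _)

theorem degree_join_lt {p₀ p₁ : R[X]} {m l : ℕ} (h₀ : p₀.degree < m) (h₁ : p₁.degree < l) :
    (p₀ + X ^ m * p₁).degree < ((m + l : ℕ) : WithBot ℕ) := by
  rw [degree_lt_iff_coeff_zero]
  intro i hi
  rw [coeff_add, coeff_X_pow_mul', if_pos (by omega), coeff_zero_of_degree_lt h₀ (by omega),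
    coeff_zero_of_degree_lt h₁ (by omega), add_zero]

theorem degree_mul_lt {p q : R[X]} {m l : ℕ} (hp : p.degree < (m + 1 : ℕ))
    (hq : q.degree < (l + 1 : ℕ)) : (p * q).degree < (m + l + 1 : ℕ) := by
  rw [degree_lt_iff_coeff_zero]
  intro i hi
  rw [coeff_mul]
  refine Finset.sum_eq_zero fun ⟨a, b⟩ hab => ?_
  rw [Finset.HasAntidiagonal.mem_antidiagonal] at hab
  rcases le_or_gt (m + 1) a with h | h
  · simp [coeff_zero_of_degree_lt hp h]
  · simp [coeff_zero_of_degree_lt hq (show l + 1 ≤ b by simp at hab; omega)]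

theorem degree_add_lt {p q : R[X]} {m : ℕ} (hp : p.degree < m) (hq : q.degree < m) :
    (p + q).degree < m := (degree_add_le p q).trans_lt (max_lt hp hq)

theorem degree_sub_lt' {p q : R[X]} {m : ℕ} (hp : p.degree < m) (hq : q.degree < m) :
    (p - q).degree < m := (degree_sub_le p q).trans_lt (max_lt hp hq)

theorem degree_C_mul_lt {p : R[X]} {m : ℕ} (a : R) (hp : p.degree < m) :
    (C a * p).degree < m := by
  rw [degree_lt_iff_coeff_zero]
  intro i hi
  rw [coeff_C_mul, coeff_zero_of_degree_lt hp hi, mul_zero]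

variable [Algebra ℝ R]

theorem Comp.poly {A : Set R} {p : R[X]} {m s t : ℕ} (hp : p.degree < m) (h0 : Comp A s {(0 : R)})
    (h : ∀ i < m, Comp A t {p.coeff i}) : Comp A (s + m * t) (coeffSet p) := by
  have := h0.union (Comp.biUnion (B := fun i => {p.coeff i}) (Finset.range m)
    fun i hi => h i (Finset.mem_range.1 hi))
  rw [Finset.card_range] at this
  refine this.mono_right ?_
  rintro _ ⟨i, rfl⟩
  by_cases hi : i < m
  · right
    simp only [Set.mem_iUnion]
    exact ⟨i, Finset.mem_range.2 hi, rfl⟩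
  · left
    rw [coeff_zero_of_degree_lt hp (not_lt.1 hi)]
    rfl

theorem Comp.polyAdd {A : Set R} {p q : R[X]} {m s t : ℕ} (hp : p.degree < m) (hq : q.degree < m)
    (h : Comp A s (coeffSet p)) (h' : Comp A t (coeffSet q)) :
    Comp A (s + t + m) (coeffSet (p + q)) := by
  refine (h.union h').trans ?_
  have := Comp.poly (A := coeffSet p ∪ coeffSet q) (s := 0) (t := 1) (degree_add_lt hp hq)
    (.of_mem (Or.inl (zero_mem_coeffSet p))) fun i _ => by
      rw [coeff_add]
      exact .of_op (.add (Or.inl ⟨i, rfl⟩) (Or.inr ⟨i, rfl⟩))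
  exact this.steps_le (by omega)

theorem Comp.polySub {A : Set R} {p q : R[X]} {m s t : ℕ} (hp : p.degree < m) (hq : q.degree < m)
    (h : Comp A s (coeffSet p)) (h' : Comp A t (coeffSet q)) :
    Comp A (s + t + m) (coeffSet (p - q)) := by
  refine (h.union h').trans ?_
  have := Comp.poly (A := coeffSet p ∪ coeffSet q) (s := 0) (t := 1) (degree_sub_lt' hp hq)
    (.of_mem (Or.inl (zero_mem_coeffSet p))) fun i _ => by
      rw [coeff_sub]
      exact .of_op (.sub (Or.inl ⟨i, rfl⟩) (Or.inr ⟨i, rfl⟩))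
  exact this.steps_le (by omega)

theorem Comp.polySmul {A : Set R} {p : R[X]} {m s : ℕ} (c : ℝ) (hp : p.degree < m)
    (h : Comp A s (coeffSet p)) :
    Comp A (s + 2 * m) (coeffSet (C (algebraMap ℝ R c) * p)) := by
  refine h.trans ?_
  have := Comp.poly (A := coeffSet p) (s := 0) (t := 2) (degree_C_mul_lt (algebraMap ℝ R c) hp)
    (.of_mem (zero_mem_coeffSet p)) fun i _ => by
      rw [coeff_C_mul]
      exact (Comp.const _ c).mul (.of_mem (coeff_mem_coeffSet p i))
  exact this.steps_le (by omega)

/-- The trinomials `X ^ (2 m) + a X ^ m + 1` of Bruun's factorization. -/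
noncomputable def bruunPoly (R : Type*) [CommRing R] [Algebra ℝ R] (m : ℕ) (a : ℝ) : R[X] :=
  X ^ (2 * m) + C (algebraMap ℝ R a) * X ^ m + 1

/-- Difference of squares: with `Y = X ^ m`, `Y⁴ + a Y² + 1 = (Y² + 1)² - r² Y²`. -/
theorem bruunPoly_factor (m : ℕ) {a r : ℝ} (h : r ^ 2 = 2 - a) :
    bruunPoly R (2 * m) a = bruunPoly R m r * bruunPoly R m (-r) := by
  have ha : a = 2 - r ^ 2 := by linarith
  subst ha
  simp only [bruunPoly, map_sub, map_pow, map_neg, map_ofNat]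
  ring

/-- The two factors differ by `2 r X ^ m`, and `X ^ m` is invertible modulo either of them, since `X
^ m * (X ^ m + r) ≡ -1` modulo the first. -/
theorem bruunPoly_isCoprime (m : ℕ) {r : ℝ} (hr : r ≠ 0) :
    IsCoprime (bruunPoly R m r) (bruunPoly R m (-r)) := by
  have hc : C (algebraMap ℝ R r) * C (algebraMap ℝ R (1 / (2 * r))) * 2 = (1 : R[X]) := by
    rw [← C_mul, ← map_mul, ← C_ofNat, ← map_ofNat (algebraMap ℝ R), ← C_mul, ← map_mul]
    rw [show r * (1 / (2 * r)) * 2 = 1 by field_simp]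
    simp
  refine ⟨1 - (X ^ m + C (algebraMap ℝ R r)) * C (algebraMap ℝ R (1 / (2 * r))),
    (X ^ m + C (algebraMap ℝ R r)) * C (algebraMap ℝ R (1 / (2 * r))), ?_⟩
  simp only [bruunPoly, map_neg]
  linear_combination (-(X ^ m) ^ 2 - C (algebraMap ℝ R r) * X ^ m) * hc

/-- Reduction modulo the two Bruun factors. -/
theorem exists_bruun_reduce {m : ℕ} (r : ℝ) {p : R[X]} (hp : p.degree < (4 * m : ℕ)) :
    ∃ s : R[X], s.degree < (2 * m : ℕ) ∧ bruunPoly R m r ∣ p - s ∧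
      Comp (coeffSet p) (20 * m) (coeffSet s) := by
  obtain ⟨p₀, q₁, rfl, d₀, e₁, c₀, k₁⟩ := exists_split m (3 * m) (hp.trans_le (by
    exact_mod_cast (show 4 * m ≤ m + 3 * m by omega)))
  obtain ⟨p₁, q₂, rfl, d₁, e₂, c₁, k₂⟩ := exists_split m (2 * m) (e₁.trans_le (by
    exact_mod_cast (show 3 * m ≤ m + 2 * m by omega)))
  obtain ⟨p₂, p₃, rfl, d₂, d₃, c₂, c₃⟩ := exists_split m m (e₂.trans_le (by
    exact_mod_cast (show 2 * m ≤ m + m by omega)))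
  set A := coeffSet (p₀ + X ^ m * (p₁ + X ^ m * (p₂ + X ^ m * p₃)))
  have h₀ : Comp A 0 (coeffSet p₀) := .done c₀
  have h₁ : Comp A 0 (coeffSet p₁) := .done (c₁.trans k₁)
  have h₂ : Comp A 0 (coeffSet p₂) := .done (c₂.trans (k₂.trans k₁))
  have h₃ : Comp A 0 (coeffSet p₃) := .done (c₃.trans (k₂.trans k₁))
  -- With `Y = X ^ m`, modulo the trinomial `Y² ≡ -r Y - 1` and `Y³ ≡ (r² - 1) Y + r`. This gives
  -- the two blocks of the remainder.
  have hu := Comp.polyAdd (degree_sub_lt' d₀ d₂) (degree_C_mul_lt _ d₃)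
    (Comp.polySub d₀ d₂ h₀ h₂) (Comp.polySmul r d₃ h₃)
  have hv := Comp.polyAdd (degree_sub_lt' d₁ (degree_C_mul_lt _ d₂)) (degree_C_mul_lt _ d₃)
    (Comp.polySub d₁ (degree_C_mul_lt _ d₂) h₁ (Comp.polySmul r d₂ h₂))
    (Comp.polySmul (r ^ 2 - 1) d₃ h₃)
  have du := degree_add_lt (degree_sub_lt' d₀ d₂) (degree_C_mul_lt (algebraMap ℝ R r) d₃)
  have dv := degree_add_lt (degree_sub_lt' d₁ (degree_C_mul_lt (algebraMap ℝ R r) d₂))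
    (degree_C_mul_lt (algebraMap ℝ R (r ^ 2 - 1)) d₃)
  have duv := degree_join_lt du dv
  rw [← two_mul] at duv
  refine ⟨_, duv, ⟨p₂ - C (algebraMap ℝ R r) * p₃ + X ^ m * p₃, ?_⟩,
    (hu.union hv).mono subset_rfl (coeffSet_join_subset du _) (by omega)⟩
  simp only [bruunPoly, map_sub, map_pow, map_one]
  ring

/-- Chinese remaindering for the two Bruun factors. -/
theorem exists_bruun_join {m : ℕ} {r : ℝ} (hr : r ≠ 0) {s t : R[X]} (hs : s.degree < (2 * m : ℕ))
    (ht : t.degree < (2 * m : ℕ)) :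
    ∃ p : R[X], p.degree < (4 * m : ℕ) ∧ bruunPoly R m r ∣ p - s ∧ bruunPoly R m (-r) ∣ p - t ∧
      Comp (coeffSet s ∪ coeffSet t) (50 * m) (coeffSet p) := by
  obtain ⟨u, v, rfl, du, dv, cu, cv⟩ := exists_split m m (hs.trans_le (by
    exact_mod_cast (show 2 * m ≤ m + m by omega)))
  obtain ⟨u', v', rfl, du', dv', cu', cv'⟩ := exists_split m m (ht.trans_le (by
    exact_mod_cast (show 2 * m ≤ m + m by omega)))
  set A := coeffSet (u + X ^ m * v) ∪ coeffSet (u' + X ^ m * v')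
  have hu : Comp A 0 (coeffSet u) := .done (cu.trans Set.subset_union_left)
  have hv : Comp A 0 (coeffSet v) := .done (cv.trans Set.subset_union_left)
  have hu' : Comp A 0 (coeffSet u') := .done (cu'.trans Set.subset_union_right)
  have hv' : Comp A 0 (coeffSet v') := .done (cv'.trans Set.subset_union_right)
  set c : ℝ := 1 / (2 * r) with hc
  have hc2 : C (algebraMap ℝ R r) * C (algebraMap ℝ R c) * 2 = (1 : R[X]) := by
    rw [← C_mul, ← map_mul, ← C_ofNat, ← map_ofNat (algebraMap ℝ R), ← C_mul, ← map_mul]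
    rw [show r * c * 2 = 1 by rw [hc]; field_simp]
    simp
  have hh : C (algebraMap ℝ R (1 / 2)) * 2 = (1 : R[X]) := by
    rw [← C_ofNat, ← map_ofNat (algebraMap ℝ R), ← C_mul, ← map_mul]
    norm_num
  have hrc : C (algebraMap ℝ R r) * C (algebraMap ℝ R c) = C (algebraMap ℝ R (1 / 2)) := by
    linear_combination C (algebraMap ℝ R (1 / 2)) * hc2 -
      C (algebraMap ℝ R r) * C (algebraMap ℝ R c) * hh
  -- The blocks `p₀, …, p₃` solve the linear system expressing that reduction modulo the factors for
  -- `r` and `-r` gives `u + X ^ m v` and `u' + X ^ m v'`. Sums and differences of its equations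
  -- decouple it.
  obtain ⟨p₃, e₃⟩ : ∃ p₃, p₃ = C (algebraMap ℝ R c) * (u - u') := ⟨_, rfl⟩
  have d₃ : p₃.degree < m := e₃ ▸ degree_C_mul_lt _ (degree_sub_lt' du du')
  have h₃ : Comp A _ (coeffSet p₃) :=
    e₃ ▸ Comp.polySmul c (degree_sub_lt' du du') (Comp.polySub du du' hu hu')
  obtain ⟨p₂, e₂⟩ : ∃ p₂, p₂ = C (algebraMap ℝ R c) * (v' - v) := ⟨_, rfl⟩
  have d₂ : p₂.degree < m := e₂ ▸ degree_C_mul_lt _ (degree_sub_lt' dv' dv)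
  have h₂ : Comp A _ (coeffSet p₂) :=
    e₂ ▸ Comp.polySmul c (degree_sub_lt' dv' dv) (Comp.polySub dv' dv hv' hv)
  obtain ⟨p₁, e₁⟩ : ∃ p₁, p₁ = C (algebraMap ℝ R (1 / 2)) * (v + v') -
    C (algebraMap ℝ R (r ^ 2 - 1)) * p₃ := ⟨_, rfl⟩
  have d₁ : p₁.degree < m := e₁ ▸ degree_sub_lt' (degree_C_mul_lt _ (degree_add_lt dv dv'))
    (degree_C_mul_lt _ d₃)
  have h₁ : Comp A _ (coeffSet p₁) :=
    e₁ ▸ Comp.polySub (degree_C_mul_lt _ (degree_add_lt dv dv')) (degree_C_mul_lt _ d₃)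
      (Comp.polySmul _ (degree_add_lt dv dv') (Comp.polyAdd dv dv' hv hv'))
      (Comp.polySmul _ d₃ h₃)
  obtain ⟨p₀, e₀⟩ : ∃ p₀, p₀ = C (algebraMap ℝ R (1 / 2)) * (u + u') + p₂ := ⟨_, rfl⟩
  have d₀ : p₀.degree < m := e₀ ▸ degree_add_lt (degree_C_mul_lt _ (degree_add_lt du du')) d₂
  have h₀ : Comp A _ (coeffSet p₀) :=
    e₀ ▸ Comp.polyAdd (degree_C_mul_lt _ (degree_add_lt du du')) d₂
      (Comp.polySmul _ (degree_add_lt du du') (Comp.polyAdd du du' hu hu')) h₂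
  have f₂ := degree_join_lt d₂ d₃
  have f₁ := degree_join_lt d₁ f₂
  have f₀ := degree_join_lt d₀ f₁
  rw [show m + (m + (m + m)) = 4 * m by ring] at f₀
  refine ⟨p₀ + X ^ m * (p₁ + X ^ m * (p₂ + X ^ m * p₃)),
    f₀,
    ⟨p₂ - C (algebraMap ℝ R r) * p₃ + X ^ m * p₃, ?_⟩,
    ⟨p₂ + C (algebraMap ℝ R r) * p₃ + X ^ m * p₃, ?_⟩,
    (h₀.union (h₁.union (h₂.union h₃))).mono subset_rfl ?_ (by omega)⟩
  · simp only [bruunPoly, map_sub, map_pow, map_one] at *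
    subst e₀ e₁ e₂ e₃
    linear_combination ((u - u') + X ^ m * (v - v')) * hrc + (u + X ^ m * v) * hh
  · simp only [bruunPoly, map_sub, map_pow, map_one, map_neg] at *
    subst e₀ e₁ e₂ e₃
    linear_combination (u' + X ^ m * v') * hh - ((u - u') + X ^ m * (v - v')) * hrc
  · exact (coeffSet_join_subset d₀ _).trans (Set.union_subset_union_right _
      ((coeffSet_join_subset d₁ _).trans (Set.union_subset_union_right _
        (coeffSet_join_subset d₂ _))))

/-- Multiplication modulo a Bruun trinomial. -/
theorem exists_bruun_mul (k : ℕ) {a : ℝ} (ha : |a| < 2) {p q : R[X]}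
    (hp : p.degree < (2 * 2 ^ k : ℕ)) (hq : q.degree < (2 * 2 ^ k : ℕ)) :
    ∃ s : R[X], s.degree < (2 * 2 ^ k : ℕ) ∧ bruunPoly R (2 ^ k) a ∣ p * q - s ∧
      Comp (coeffSet p ∪ coeffSet q) (90 * ((k + 1) * 2 ^ k)) (coeffSet s) := by
  induction k generalizing a p q with
  | zero =>
    simp only [pow_zero, mul_one] at hp hq ⊢
    obtain ⟨p₀, p₁, rfl, d₀, d₁, c₀, c₁⟩ := exists_split 1 1 hp
    obtain ⟨q₀, q₁, rfl, e₀, e₁, k₀, k₁⟩ := exists_split 1 1 hq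
    set A := coeffSet (p₀ + X ^ 1 * p₁) ∪ coeffSet (q₀ + X ^ 1 * q₁)
    have hm : ∀ {x y : R[X]}, x.degree < (1 : ℕ) → y.degree < (1 : ℕ) →
        coeffSet x ⊆ A → coeffSet y ⊆ A →
        (x * y).degree < (1 : ℕ) ∧ Comp A 1 (coeffSet (x * y)) := by
      intro x y hx hy hxA hyA
      refine ⟨by simpa using degree_mul_lt (m := 0) (l := 0) hx hy, ?_⟩
      refine (Comp.poly (m := 1) (s := 0) (t := 1) (degree_mul_lt (m := 0) (l := 0) hx hy)
        (.of_mem (hxA (zero_mem_coeffSet x))) fun i hi => ?_).steps_le (by omega)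
      obtain rfl : i = 0 := by omega
      rw [mul_coeff_zero]
      exact .of_op (.mul (hxA (coeff_mem_coeffSet _ _)) (hyA (coeff_mem_coeffSet _ _)))
    obtain ⟨d00, h00⟩ := hm d₀ e₀ (c₀.trans Set.subset_union_left) (k₀.trans Set.subset_union_right)
    obtain ⟨d01, h01⟩ := hm d₀ e₁ (c₀.trans Set.subset_union_left) (k₁.trans Set.subset_union_right)
    obtain ⟨d10, h10⟩ := hm d₁ e₀ (c₁.trans Set.subset_union_left) (k₀.trans Set.subset_union_right)
    obtain ⟨d11, h11⟩ := hm d₁ e₁ (c₁.trans Set.subset_union_left) (k₁.trans Set.subset_union_right)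
    have hu := Comp.polySub d00 d11 h00 h11
    have hv := Comp.polySub (degree_add_lt d01 d10) (degree_C_mul_lt _ d11)
      (Comp.polyAdd d01 d10 h01 h10) (Comp.polySmul a d11 h11)
    have du := degree_sub_lt' d00 d11
    have dv := degree_sub_lt' (degree_add_lt d01 d10) (degree_C_mul_lt (algebraMap ℝ R a) d11)
    refine ⟨_, degree_join_lt du dv, ⟨p₁ * q₁, ?_⟩,
      (hu.union hv).mono subset_rfl (coeffSet_join_subset du _) (by omega)⟩
    simp only [bruunPoly]
    ring
  | succ k ih =>
    obtain ⟨ha1, ha2⟩ := abs_lt.1 ha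
    -- `|a| < 2` makes `0 < r < 2`, so both `r` and `-r` again satisfy the hypothesis and the
    -- recursion never leaves the reals.
    set r := √(2 - a) with hr
    have hr2 : r ^ 2 = 2 - a := Real.sq_sqrt (by linarith)
    have hr0 : 0 < r := Real.sqrt_pos.2 (by linarith)
    have hr1 : r < 2 := by nlinarith
    have e4 : 2 * 2 ^ (k + 1) = 4 * 2 ^ k := by ring
    rw [e4] at hp hq
    obtain ⟨p', dp', vp', cp'⟩ := exists_bruun_reduce r hp
    obtain ⟨q', dq', vq', cq'⟩ := exists_bruun_reduce r hq
    obtain ⟨p'', dp'', vp'', cp''⟩ := exists_bruun_reduce (-r) hp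
    obtain ⟨q'', dq'', vq'', cq''⟩ := exists_bruun_reduce (-r) hq
    obtain ⟨s', ds', vs', cs'⟩ := ih (a := r) (by rw [abs_of_pos hr0]; exact hr1) dp' dq'
    obtain ⟨s'', ds'', vs'', cs''⟩ :=
      ih (a := -r) (by rw [abs_neg, abs_of_pos hr0]; exact hr1) dp'' dq''
    obtain ⟨s, ds, v₁, v₂, cs⟩ := exists_bruun_join hr0.ne' ds' ds''
    refine ⟨s, by rwa [e4], ?_, ?_⟩
    · rw [pow_succ', bruunPoly_factor _ hr2]
      refine (bruunPoly_isCoprime _ hr0.ne').mul_dvd ?_ ?_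
      · have : p * q - s = (p - p') * q + p' * (q - q') + (p' * q' - s') - (s - s') := by ring
        rw [this]
        exact (((vp'.mul_right _).add (vq'.mul_left _)).add vs').sub v₁
      · have : p * q - s = (p - p'') * q + p'' * (q - q'') + (p'' * q'' - s'') - (s - s'') := by
          ring
        rw [this]
        exact (((vp''.mul_right _).add (vq''.mul_left _)).add vs'').sub v₂
    · have l : coeffSet p ⊆ coeffSet p ∪ coeffSet q := Set.subset_union_left
      have l' : coeffSet q ⊆ coeffSet p ∪ coeffSet q := Set.subset_union_right
      have h' := ((cp'.mono_left l).union (cq'.mono_left l')).trans cs'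
      have h'' := ((cp''.mono_left l).union (cq''.mono_left l')).trans cs''
      refine ((h'.union h'').trans cs).steps_le ?_
      rw [pow_succ]
      generalize 2 ^ k = E
      nlinarith

/-- A bound for the cost of multiplying two polynomials of degree less than `2 ^ k`. -/
def mulCost (k : ℕ) : ℕ := 90 * ((k + 1) * 2 ^ k)

/-- Multiplication modulo `X ^ (2 * 2 ^ k) + 1`, the trinomial with `a = 0`. The product has smaller
degree than this modulus, so the residue is the product itself. -/
theorem Comp.polyMul (k : ℕ) {p q : R[X]} (hp : p.degree < (2 ^ k : ℕ))
    (hq : q.degree < (2 ^ k : ℕ)) :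
    Comp (coeffSet p ∪ coeffSet q) (mulCost k) (coeffSet (p * q)) := by
  have hle : ((2 ^ k : ℕ) : WithBot ℕ) ≤ (2 * 2 ^ k : ℕ) := by
    exact_mod_cast (show 2 ^ k ≤ 2 * 2 ^ k by omega)
  obtain ⟨s, ds, ⟨w, hw⟩, cs⟩ := exists_bruun_mul k (a := 0) (by simp) (hp.trans_le hle)
    (hq.trans_le hle)
  have hpq : (p * q).degree < (2 * 2 ^ k : ℕ) := by
    obtain ⟨e, he⟩ : ∃ e, 2 ^ k = e + 1 := ⟨2 ^ k - 1, by have := Nat.two_pow_pos k; omega⟩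
    rw [he] at hp hq ⊢
    exact (degree_mul_lt hp hq).trans_le (by exact_mod_cast (by omega))
  rcases subsingleton_or_nontrivial R with hR | hR
  · exact cs.mono_right (by rintro x -; exact ⟨0, Subsingleton.elim _ _⟩)
  have hdeg : (X ^ (2 * 2 ^ k) + 1 : R[X]).degree = (2 * 2 ^ k : ℕ) := by
    rw [← C_1, degree_X_pow_add_C (by positivity)]
  have hmon : (X ^ (2 * 2 ^ k) + 1 : R[X]).Monic := by
    rw [← C_1]; exact monic_X_pow_add_C _ (by positivity)
  have : p * q - s = 0 := by
    by_contra h0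
    refine hmon.not_dvd_of_degree_lt h0 ?_ ⟨w, ?_⟩
    · rw [hdeg]; exact degree_sub_lt' hpq ds
    · rw [hw]; simp [bruunPoly]
  rw [sub_eq_zero.1 this]
  exact cs

end FastPolynomial

/-! ### Fast inversion of power series, multipoint evaluation -/

section MultipointEvaluation

open Polynomial

variable {R : Type*} [CommRing R]

/-! ### Newton iteration for power series -/

theorem X_pow_dvd_sub_ofSeq (m : ℕ) (G : PowerSeries R) :
    (PowerSeries.X : PowerSeries R) ^ m ∣ G - (ofSeq m fun i => PowerSeries.coeff i G : R[X]) := by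
  rw [PowerSeries.X_pow_dvd_iff]
  intro i hi
  rw [map_sub, Polynomial.coeff_coe, coeff_ofSeq, if_pos hi, sub_self]

/-- One Newton step for the inverse `G` of `q`. -/
theorem newton_step {q : R[X]} {G : PowerSeries R} (hG : (q : PowerSeries R) * G = 1) (m : ℕ) :
    let g := ofSeq m fun i => PowerSeries.coeff i G
    ofSeq (2 * m) (fun i => PowerSeries.coeff i G) =
      ofSeq (2 * m) (g + g - ofSeq (2 * m) q.coeff * (g * g)).coeff := by
  intro g
  have h₁ : (PowerSeries.X : PowerSeries R) ^ m ∣ G - g := X_pow_dvd_sub_ofSeq m G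
  have h₂ : (PowerSeries.X : PowerSeries R) ^ (2 * m) ∣
      (q : PowerSeries R) - (ofSeq (2 * m) q.coeff : R[X]) := by
    simpa using X_pow_dvd_sub_ofSeq (2 * m) (q : PowerSeries R)
  have h₃ : (PowerSeries.X : PowerSeries R) ^ (2 * m) ∣
      ((g + g - ofSeq (2 * m) q.coeff * (g * g) : R[X]) : PowerSeries R) - G := by
    -- The error of the Newton iterate is quadratic in `G - g`, up to the truncation error of `q`.
    have : ((g + g - ofSeq (2 * m) q.coeff * (g * g) : R[X]) : PowerSeries R) - G =
        ((q : PowerSeries R) - (ofSeq (2 * m) q.coeff : R[X])) * (g * g) -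
          q * ((G - g) * (G - g)) := by
      push_cast
      linear_combination (G - 2 * (g : PowerSeries R)) * hG
    rw [this]
    refine (h₂.mul_right _).sub (Dvd.dvd.mul_left ?_ _)
    rw [two_mul, pow_add]
    exact mul_dvd_mul h₁ h₁
  rw [PowerSeries.X_pow_dvd_iff] at h₃
  ext i
  rw [coeff_ofSeq, coeff_ofSeq]
  split_ifs with hi
  · have := h₃ i hi
    rw [map_sub, Polynomial.coeff_coe, sub_eq_zero] at this
    exact this.symm
  · rfl

/-! ### Polynomials acting on sequences by the shift -/

theorem degree_lt_of_natDegree_lt' {p : R[X]} {d : ℕ} (h : p.natDegree < d) : p.degree < d := by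
  rw [degree_lt_iff_coeff_zero]
  exact fun i hi => coeff_eq_zero_of_natDegree_lt (h.trans_le hi)

/-- The action of polynomials on sequences in which `X` acts as the shift. -/
noncomputable def seqAct (p : R[X]) : Module.End R (ℕ → R) :=
  aeval (LinearMap.funLeft R R Nat.succ) p

theorem seqAct_mul (p q : R[X]) (h : ℕ → R) : seqAct (p * q) h = seqAct p (seqAct q h) := by
  simp [seqAct]

theorem seqAct_comm (p q : R[X]) (h : ℕ → R) :
    seqAct p (seqAct q h) = seqAct q (seqAct p h) := by
  rw [← seqAct_mul, mul_comm, seqAct_mul]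

theorem funLeft_succ_pow_apply (l : ℕ) (h : ℕ → R) (n : ℕ) :
    ((LinearMap.funLeft R R Nat.succ : Module.End R (ℕ → R)) ^ l) h n = h (n + l) := by
  induction l generalizing h with
  | zero => simp
  | succ l ih =>
    rw [pow_succ, Module.End.mul_apply, ih, LinearMap.funLeft_apply]
    rfl

theorem seqAct_apply {p : R[X]} {d : ℕ} (hp : p.degree < d) (h : ℕ → R) (n : ℕ) :
    seqAct p h n = ∑ l ∈ Finset.range d, p.coeff l * h (n + l) := by
  have hp' : p = ∑ l ∈ Finset.range d, monomial l (p.coeff l) := by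
    ext i
    change _ = (ofSeq d p.coeff).coeff i
    rw [coeff_ofSeq]
    split_ifs with hi
    · rfl
    · exact coeff_zero_of_degree_lt hp (not_lt.1 hi)
  conv_lhs => rw [hp']
  simp only [seqAct, map_sum, LinearMap.sum_apply, Finset.sum_apply, aeval_monomial]
  refine Finset.sum_congr rfl fun l _ => ?_
  rw [Module.End.mul_apply, Module.algebraMap_end_apply, Pi.smul_apply, funLeft_succ_pow_apply,
    smul_eq_mul]

/-- `X ^ d * p (1 / X)`. -/
noncomputable def revPoly (d : ℕ) (p : R[X]) : R[X] := ofSeq (d + 1) fun j => p.coeff (d - j)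

theorem coeffSet_revPoly_subset (d : ℕ) (p : R[X]) : coeffSet (revPoly d p) ⊆ coeffSet p := by
  refine (coeffSet_ofSeq_subset _ _).trans (Set.union_subset ?_ ?_)
  · simpa using zero_mem_coeffSet p
  · rintro _ ⟨i, -, rfl⟩
    exact coeff_mem_coeffSet _ _

/-- The action is a correlation, that is, a convolution with the reversed polynomial. A window of
the sequence acted upon thus costs one polynomial multiplication. -/
theorem seqAct_eq_coeff {p : R[X]} {d L n : ℕ} (hp : p.degree < (d + 1 : ℕ)) (hL : n + d < L)
    (h : ℕ → R) : seqAct p h n = (revPoly d p * ofSeq L h).coeff (n + d) := by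
  rw [seqAct_apply hp, coeff_mul, Finset.Nat.sum_antidiagonal_eq_sum_range_succ_mk,
    ← Finset.sum_range_reflect]
  have hsub : Finset.range (d + 1) ⊆ Finset.range (n + d).succ := by
    intro j; simp; omega
  rw [← Finset.sum_subset hsub]
  · refine Finset.sum_congr rfl fun j hj => ?_
    rw [Finset.mem_range] at hj
    rw [revPoly, coeff_ofSeq, coeff_ofSeq, if_pos hj, if_pos (by omega)]
    rw [show d + 1 - 1 - j = d - j by omega, show n + (d - j) = n + d - j by omega]
  · intro j _ hj
    rw [Finset.mem_range] at hj
    rw [revPoly, coeff_ofSeq, if_neg hj, zero_mul]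

/-- The polynomial with roots `α 0, …, α (2 ^ k - 1)`. -/
noncomputable def nodePoly (k : ℕ) (α : ℕ → R) : R[X] := ∏ i ∈ Finset.range (2 ^ k), (X - C (α i))

/-- The product of the linear factors of `nodePoly k α`, except that for `α i`. -/
noncomputable def coPoly (k : ℕ) (α : ℕ → R) (i : ℕ) : R[X] :=
  ∏ j ∈ Finset.range (2 ^ k), if j = i then 1 else (X - C (α j))

theorem nodePoly_succ (k : ℕ) (α : ℕ → R) :
    nodePoly (k + 1) α = nodePoly k α * nodePoly k fun i => α (2 ^ k + i) := by
  rw [nodePoly, pow_succ, mul_two, Finset.prod_range_add]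
  rfl

/-- The recursion behind the descent: for a node in one half, the node polynomial of the other half
splits off whole. -/
theorem coPoly_succ_left (k : ℕ) (α : ℕ → R) {i : ℕ} (hi : i < 2 ^ k) :
    coPoly (k + 1) α i = coPoly k α i * nodePoly k fun i => α (2 ^ k + i) := by
  rw [coPoly, pow_succ, mul_two, Finset.prod_range_add]
  congr 1
  exact Finset.prod_congr rfl fun j _ => if_neg (by omega)

theorem coPoly_succ_right (k : ℕ) (α : ℕ → R) (i : ℕ) :
    coPoly (k + 1) α (2 ^ k + i) = (coPoly k (fun i => α (2 ^ k + i)) i) * nodePoly k α := by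
  rw [coPoly, pow_succ, mul_two, Finset.prod_range_add, mul_comm]
  congr 1
  · exact Finset.prod_congr rfl fun j _ => by simp
  · refine Finset.prod_congr rfl fun j hj => if_neg ?_
    rw [Finset.mem_range] at hj
    omega

theorem coPoly_mul (k : ℕ) (α : ℕ → R) {i : ℕ} (hi : i < 2 ^ k) :
    coPoly k α i * (X - C (α i)) = nodePoly k α := by
  have hi' : i ∈ Finset.range (2 ^ k) := Finset.mem_range.2 hi
  rw [coPoly, nodePoly, ← Finset.mul_prod_erase _ _ hi', ← Finset.mul_prod_erase _ _ hi', if_pos rfl,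
    one_mul, mul_comm]
  congr 1
  exact Finset.prod_congr rfl fun j hj => if_neg (Finset.ne_of_mem_erase hj)

theorem nodePoly_monic (k : ℕ) (α : ℕ → R) : (nodePoly k α).Monic :=
  monic_prod_of_monic _ _ fun _ _ => monic_X_sub_C _

theorem coPoly_monic (k : ℕ) (α : ℕ → R) (i : ℕ) : (coPoly k α i).Monic :=
  monic_prod_of_monic _ _ fun _ _ => by
    split_ifs
    · exact monic_one
    · exact monic_X_sub_C _

theorem natDegree_nodePoly [Nontrivial R] (k : ℕ) (α : ℕ → R) :
    (nodePoly k α).natDegree = 2 ^ k := by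
  rw [nodePoly, natDegree_prod_of_monic _ _ fun i _ => monic_X_sub_C _]
  simp

theorem natDegree_coPoly [Nontrivial R] (k : ℕ) (α : ℕ → R) {i : ℕ} (hi : i < 2 ^ k) :
    (coPoly k α i).natDegree + 1 = 2 ^ k := by
  rw [← natDegree_nodePoly k α, ← coPoly_mul k α hi,
    (coPoly_monic k α i).natDegree_mul (monic_X_sub_C _), natDegree_X_sub_C]

theorem degree_nodePoly_lt (k : ℕ) (α : ℕ → R) : (nodePoly k α).degree < (2 ^ k + 1 : ℕ) := by
  rcases subsingleton_or_nontrivial R with hR | hR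
  · rw [Subsingleton.elim (nodePoly k α) 0, degree_zero]
    exact WithBot.bot_lt_coe _
  · exact degree_lt_of_natDegree_lt' (by rw [natDegree_nodePoly]; omega)

/-- The expansion at infinity of the inverse of a monic polynomial, as a sequence. -/
theorem seqAct_inverse_eq_zero {P : R[X]} {N : ℕ} (hN : 0 < N) (hP : P.degree < (N + 1 : ℕ))
    {G : PowerSeries R} (hG : (revPoly N P : PowerSeries R) * G = 1) :
    seqAct P (fun n => if n + 1 < N then 0 else PowerSeries.coeff (n + 1 - N) G) = 0 := by
  ext n
  rw [seqAct_apply hP, ← Finset.sum_range_reflect]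
  -- Entry `n` of the action is the coefficient of `X ^ (-(n + 1))` in `P * (1 / P)`. After reversal
  -- it is the coefficient of `X ^ (n + 1)` in `revPoly N P * G = 1`, which is zero.
  have h := congrArg (PowerSeries.coeff (n + 1)) hG
  rw [PowerSeries.coeff_mul, Finset.Nat.sum_antidiagonal_eq_sum_range_succ_mk,
    PowerSeries.coeff_one, if_neg (by omega)] at h
  refine Eq.trans ?_ h
  have h₁ : Finset.range (N + 1) ⊆ Finset.range (N + 1 + n + 2) := by intro j; simp; omega
  have h₂ : Finset.range (n + 1).succ ⊆ Finset.range (N + 1 + n + 2) := by intro j; simp; omega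
  have e : ∀ j ≤ N, P.coeff (N + 1 - 1 - j) * (if n + (N + 1 - 1 - j) + 1 < N then 0 else
      PowerSeries.coeff (n + (N + 1 - 1 - j) + 1 - N) G) =
      if j ≤ N ∧ j ≤ n + 1 then P.coeff (N - j) * PowerSeries.coeff (n + 1 - j) G else 0 := by
    intro j hj
    by_cases hj' : j ≤ n + 1
    · rw [if_pos (show j ≤ N ∧ j ≤ n + 1 from ⟨hj, hj'⟩),
        if_neg (show ¬ n + (N + 1 - 1 - j) + 1 < N by omega),
        show n + (N + 1 - 1 - j) + 1 - N = n + 1 - j by omega, Nat.add_sub_cancel]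
    · rw [if_neg (show ¬ (j ≤ N ∧ j ≤ n + 1) by omega),
        if_pos (show n + (N + 1 - 1 - j) + 1 < N by omega), mul_zero]
  trans ∑ j ∈ Finset.range (N + 1 + n + 2),
    if j ≤ N ∧ j ≤ n + 1 then P.coeff (N - j) * PowerSeries.coeff (n + 1 - j) G else 0
  · rw [← Finset.sum_subset h₁]
    · refine Finset.sum_congr rfl fun j hj => ?_
      rw [Finset.mem_range] at hj
      exact e j (by omega)
    · intro j _ hj
      rw [Finset.mem_range] at hj
      rw [if_neg (by omega)]
  · rw [← Finset.sum_subset h₂]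
    · refine Finset.sum_congr rfl fun j hj => ?_
      rw [Finset.mem_range] at hj
      rw [Polynomial.coeff_coe, revPoly, coeff_ofSeq]
      by_cases hj' : j ≤ N
      · rw [if_pos ⟨hj', by omega⟩, if_pos (by omega)]
      · rw [if_neg (by omega), if_neg (by omega), zero_mul]
    · intro j _ hj
      rw [Finset.mem_range] at hj
      rw [if_neg (by omega)]

/-- Evaluation of a polynomial at the roots of `nodePoly k α` from the expansion at infinity of the
inverse of `nodePoly k α`. -/
theorem seqAct_coPoly_apply_zero (k : ℕ) (α : ℕ → R) {G : PowerSeries R}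
    (hG : (revPoly (2 ^ k) (nodePoly k α) : PowerSeries R) * G = 1) {p : R[X]} {i : ℕ}
    (hi : i < 2 ^ k) :
    seqAct (coPoly k α i) (seqAct p
      (fun n => if n + 1 < 2 ^ k then 0 else PowerSeries.coeff (n + 1 - 2 ^ k) G)) 0 =
        p.eval (α i) := by
  rcases subsingleton_or_nontrivial R with hR | hR
  · exact Subsingleton.elim _ _
  set g : ℕ → R := fun n => if n + 1 < 2 ^ k then 0 else PowerSeries.coeff (n + 1 - 2 ^ k) G
    with hg
  have hN := Nat.two_pow_pos k
  have hg0 : seqAct (nodePoly k α) g = 0 :=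
    seqAct_inverse_eq_zero hN (degree_nodePoly_lt k α) hG
  -- Formally `coPoly / nodePoly = 1 / (X - α i)`, whose expansion at infinity is the geometric
  -- sequence `α i ^ n`. Acting on it with `p` and reading entry 0 gives `∑ l, p.coeff l * α i ^ l`.
  set e := seqAct (coPoly k α i) g with he
  have hG0 : PowerSeries.coeff 0 G = 1 := by
    have h := congrArg (PowerSeries.coeff 0) hG
    have hc : (nodePoly k α).coeff (2 ^ k) = 1 := by
      have := (nodePoly_monic k α).coeff_natDegree
      rwa [natDegree_nodePoly] at this
    simpa [revPoly, coeff_ofSeq, hc, PowerSeries.coeff_mul, -PowerSeries.coeff_zero_eq_constantCoeff] using h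
  have hd := natDegree_coPoly k α hi
  -- `g` vanishes below index `2 ^ k - 1`, so only the leading coefficient of `coPoly` contributes.
  have he0 : e 0 = 1 := by
    rw [he, seqAct_apply (d := 2 ^ k) (degree_lt_of_natDegree_lt' (by omega)),
      Finset.sum_eq_single (2 ^ k - 1)]
    · have := (coPoly_monic k α i).coeff_natDegree
      rw [show (coPoly k α i).natDegree = 2 ^ k - 1 by omega] at this
      rw [this, one_mul, hg]
      simp only
      rw [if_neg (by omega), ← hG0]
      congr 1
      congr 1
      omega
    · intro l hl hl'
      rw [Finset.mem_range] at hl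
      rw [hg]
      simp only
      rw [if_pos (by omega), mul_zero]
    · intro h; simp at h
  have hstep : ∀ n, e (n + 1) = α i * e n := by
    intro n
    have h1 : seqAct (X - C (α i)) e = 0 := by
      rw [he, ← seqAct_mul, mul_comm, coPoly_mul k α hi, hg0]
    have h2 := congrFun h1 n
    rw [seqAct_apply (d := 2) ((degree_X_sub_C_le _).trans_lt (by exact_mod_cast one_lt_two))] at h2
    simp [Finset.sum_range_succ, coeff_X, coeff_C] at h2
    linear_combination h2
  have hpow : ∀ n, e n = α i ^ n := by
    intro n
    induction n with
    | zero => rw [he0, pow_zero]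
    | succ n ih => rw [hstep, ih, pow_succ']
  rw [seqAct_comm, ← he, seqAct_apply (d := p.natDegree + 1)
    (degree_lt_of_natDegree_lt' (Nat.lt_succ_self _)), eval_eq_sum_range]
  exact Finset.sum_congr rfl fun l _ => by rw [hpow, zero_add]

/-- The coefficients of all polynomials of the subproduct tree. -/
noncomputable def treeCoeffs : ℕ → (ℕ → R) → Set R
  | 0, α => coeffSet (nodePoly 0 α)
  | k + 1, α => treeCoeffs k α ∪ treeCoeffs k (fun i => α (2 ^ k + i)) ∪
      coeffSet (nodePoly (k + 1) α)

theorem coeffSet_nodePoly_subset (k : ℕ) (α : ℕ → R) :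
    coeffSet (nodePoly k α) ⊆ treeCoeffs k α := by
  cases k with
  | zero => exact subset_rfl
  | succ k => exact Set.subset_union_right

/-! ### Operation counts for inversion, subproduct tree and evaluation -/

variable [Algebra ℝ R]

/-- Each Newton step doubles the precision at the price of two multiplications. The costs grow
geometrically, so the total keeps a single logarithm. -/
theorem Comp.powerSeriesInv {q : R[X]} {G : PowerSeries R} (hG : (q : PowerSeries R) * G = 1)
    (hq : q.coeff 0 = 1) (t : ℕ) :
    Comp (coeffSet q) (400 * ((t + 1) * 2 ^ t))
      (coeffSet (ofSeq (2 ^ t) fun i => PowerSeries.coeff i G)) := by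
  induction t with
  | zero =>
    refine (Comp.poly (m := 1) (t := 1) (degree_ofSeq_lt _ _) (Comp.zero _)
      fun i hi => ?_).steps_le (by norm_num)
    obtain rfl : i = 0 := by omega
    have h : PowerSeries.coeff 0 G = 1 := by
      simpa [hq, PowerSeries.coeff_mul, -PowerSeries.coeff_zero_eq_constantCoeff] using
        congrArg (PowerSeries.coeff 0) hG
    rw [coeff_ofSeq, if_pos (by norm_num), h]
    exact Comp.one _
  | succ t ih =>
    have hs := newton_step hG (2 ^ t)
    set g := ofSeq (2 ^ t) fun i => PowerSeries.coeff i G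
    simp only at hs
    rw [pow_succ', hs]
    set q' := ofSeq (2 * 2 ^ t) q.coeff
    have hgd : g.degree < (2 ^ t : ℕ) := degree_ofSeq_lt _ _
    have hN := Nat.two_pow_pos t
    have e1 : 2 ^ (t + 1) = 2 * 2 ^ t := pow_succ' _ _
    have e2 : 2 ^ (t + 2) = 4 * 2 ^ t := by ring
    have hle : ∀ {a b : ℕ}, a ≤ b → (a : WithBot ℕ) ≤ b := fun h => by exact_mod_cast h
    have hg1 : g.degree < (2 ^ (t + 1) : ℕ) := hgd.trans_le (hle (by omega))
    have hgg : (g * g).degree < (2 ^ (t + 1) : ℕ) := by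
      obtain ⟨E, hE⟩ : ∃ E, 2 ^ t = E + 1 := ⟨2 ^ t - 1, by omega⟩
      rw [hE] at hgd
      exact (degree_mul_lt hgd hgd).trans_le (hle (by omega))
    have hq'd : q'.degree < (2 ^ (t + 1) : ℕ) := e1 ▸ degree_ofSeq_lt _ _
    have hq' : coeffSet q' ⊆ coeffSet q := by
      refine (coeffSet_ofSeq_subset _ _).trans (Set.union_subset ?_ ?_)
      · simpa using zero_mem_coeffSet q
      · rintro _ ⟨i, -, rfl⟩
        exact coeff_mem_coeffSet _ _
    have h1 : Comp (coeffSet q ∪ coeffSet g) (mulCost (t + 1)) (coeffSet (g * g)) :=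
      (Comp.polyMul (t + 1) hg1 hg1).mono_left (by simp)
    have h2 : Comp (coeffSet q ∪ coeffSet g ∪ coeffSet (g * g)) (mulCost (t + 1))
        (coeffSet (q' * (g * g))) :=
      (Comp.polyMul (t + 1) hq'd hgg).mono_left (Set.union_subset_union_left _
        (hq'.trans Set.subset_union_left))
    have h3 := h1.bind h2
    have h4 : Comp (coeffSet q ∪ coeffSet g ∪ coeffSet (q' * (g * g))) (2 * 2 ^ t * 2)
        (coeffSet (ofSeq (2 * 2 ^ t) (g + g - q' * (g * g)).coeff)) := by
      have m0 : (0 : R) ∈ coeffSet q ∪ coeffSet g ∪ coeffSet (q' * (g * g)) :=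
        Or.inl (Or.inr (zero_mem_coeffSet g))
      refine (Comp.poly (s := 0) (t := 2) (degree_ofSeq_lt _ _) (.of_mem m0)
        fun i hi => ?_).steps_le (by omega)
      rw [coeff_ofSeq, if_pos hi, coeff_sub, coeff_add]
      have m1 : g.coeff i ∈ coeffSet q ∪ coeffSet g ∪ coeffSet (q' * (g * g)) :=
        Or.inl (Or.inr (coeff_mem_coeffSet g i))
      have m2 : (q' * (g * g)).coeff i ∈ coeffSet q ∪ coeffSet g ∪ coeffSet (q' * (g * g)) :=
        Or.inr (coeff_mem_coeffSet _ i)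
      exact (Comp.of_op (.add m1 m1)).sub (.of_mem m2)
    refine (ih.bind (h3.bind h4)).steps_le ?_
    rw [mulCost, e1]
    generalize 2 ^ t = E
    nlinarith

/-- Every level of the tree costs `O(k 2 ^ k)` by fast multiplication. The number of levels
contributes the second logarithm. -/
theorem Comp.tree (k : ℕ) (α : ℕ → R) :
    Comp (Set.range α) (90 * ((k + 1) ^ 2 * 2 ^ k)) (treeCoeffs k α) := by
  induction k generalizing α with
  | zero =>
    have h := ((Comp.zero (Set.range α)).union (Comp.one _)).union
      ((Comp.zero _).sub (Comp.of_mem ⟨0, rfl⟩))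
    refine h.mono subset_rfl ?_ (by norm_num)
    rintro _ ⟨i, rfl⟩
    simp only [nodePoly, pow_zero, Finset.prod_range_one, coeff_sub]
    match i with
    | 0 => right; simp
    | 1 => left; right; simp
    | i + 2 => left; left; simp [coeff_X]
  | succ k ih =>
    have h1 := ih α
    have h2 := (ih fun i => α (2 ^ k + i)).mono_left (A' := Set.range α)
      (by rintro _ ⟨i, rfl⟩; exact ⟨_, rfl⟩)
    have hle : ((2 ^ k + 1 : ℕ) : WithBot ℕ) ≤ (2 ^ (k + 1) : ℕ) := by
      have := Nat.two_pow_pos k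
      exact_mod_cast (show 2 ^ k + 1 ≤ 2 ^ (k + 1) by rw [pow_succ]; omega)
    have h3 : Comp (Set.range α ∪ (treeCoeffs k α ∪ treeCoeffs k fun i => α (2 ^ k + i)))
        (mulCost (k + 1)) (coeffSet (nodePoly (k + 1) α)) := by
      rw [nodePoly_succ]
      exact (Comp.polyMul (k + 1) ((degree_nodePoly_lt k _).trans_le hle)
        ((degree_nodePoly_lt k _).trans_le hle)).mono_left
          ((Set.union_subset_union (coeffSet_nodePoly_subset k _)
            (coeffSet_nodePoly_subset k _)).trans Set.subset_union_right)
    refine ((h1.union h2).bind_keep h3).steps_le ?_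
    rw [mulCost, pow_succ 2 k]
    generalize 2 ^ k = E
    nlinarith [Nat.zero_le (E * k)]

theorem Comp.polyAct {A : Set R} {k d n L : ℕ} {p : R[X]} {h : ℕ → R}
    (hp : p.degree < (d + 1 : ℕ)) (hn : n + d ≤ L) (hd : d < 2 ^ k) (hL : L ≤ 2 ^ k)
    (hpA : coeffSet p ⊆ A) (hA : h '' Set.Iio L ⊆ A) :
    Comp A (mulCost k) (seqAct p h '' Set.Iio n) := by
  have hle : ∀ {a b : ℕ}, a ≤ b → (a : WithBot ℕ) ≤ b := fun h => by exact_mod_cast h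
  refine (Comp.polyMul k (p := revPoly d p) (q := ofSeq L h)
    ((degree_ofSeq_lt _ _).trans_le (hle (by omega)))
    ((degree_ofSeq_lt _ _).trans_le (hle hL))).mono ?_ ?_ le_rfl
  · refine Set.union_subset ((coeffSet_revPoly_subset d p).trans hpA)
      ((coeffSet_ofSeq_subset _ _).trans (Set.union_subset ?_ hA))
    simpa using hpA (zero_mem_coeffSet p)
  · rintro _ ⟨i, hi, rfl⟩
    rw [Set.mem_Iio] at hi
    rw [seqAct_eq_coeff hp (L := L) (by omega)]
    exact coeff_mem_coeffSet _ _

/-- The descent in the subproduct tree. -/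
theorem Comp.treeDescent (k : ℕ) (α h : ℕ → R) {A : Set R} (ht : treeCoeffs k α ⊆ A)
    (hA : h '' Set.Iio (2 ^ k) ⊆ A) :
    Comp A (180 * ((k + 1) ^ 2 * 2 ^ k))
      ((fun i => seqAct (coPoly k α i) h 0) '' Set.Iio (2 ^ k)) := by
  induction k generalizing α h A with
  | zero =>
    refine .done ?_
    rintro _ ⟨i, hi, rfl⟩
    obtain rfl : i = 0 := by simpa using hi
    refine hA ⟨0, by simp, ?_⟩
    simp [coPoly, seqAct]
  | succ k ih =>
    have e1 : 2 ^ (k + 1) = 2 ^ k + 2 ^ k := by ring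
    have hN := Nat.two_pow_pos k
    have t1 : treeCoeffs k α ⊆ A := (Set.subset_union_left.trans Set.subset_union_left).trans ht
    have t2 : treeCoeffs k (fun i => α (2 ^ k + i)) ⊆ A :=
      (Set.subset_union_right.trans Set.subset_union_left).trans ht
    -- For the left nodes, act first with the node polynomial of the right half, and conversely.
    -- Only `2 ^ k` entries are kept, since a co-polynomial of degree below `2 ^ k` reads no more of
    -- them to produce entry 0.
    have h1 := Comp.polyAct (k := k + 1) (n := 2 ^ k) (degree_nodePoly_lt k _) e1.ge (by omega) le_rfl
      ((coeffSet_nodePoly_subset k fun i => α (2 ^ k + i)).trans t2) hA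
    have h2 := Comp.polyAct (k := k + 1) (n := 2 ^ k) (degree_nodePoly_lt k _) e1.ge (by omega) le_rfl
      ((coeffSet_nodePoly_subset k α).trans t1) hA
    have d1 := h1.bind (ih α _ (t1.trans Set.subset_union_left) Set.subset_union_right)
    have d2 := h2.bind (ih (fun i => α (2 ^ k + i)) _ (t2.trans Set.subset_union_left)
      Set.subset_union_right)
    refine (d1.union d2).mono subset_rfl ?_ ?_
    · rintro _ ⟨i, hi, rfl⟩
      rw [Set.mem_Iio] at hi
      by_cases hik : i < 2 ^ k
      · left
        refine ⟨i, hik, ?_⟩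
        simp only
        rw [coPoly_succ_left k α hik, seqAct_mul]
      · right
        obtain ⟨j, rfl⟩ : ∃ j, i = 2 ^ k + j := ⟨i - 2 ^ k, by omega⟩
        refine ⟨j, by rw [Set.mem_Iio]; omega, ?_⟩
        simp only
        rw [coPoly_succ_right, seqAct_mul]
    · rw [mulCost, pow_succ 2 k]
      generalize 2 ^ k = E
      nlinarith [Nat.zero_le (E * k)]

/-- Fast multipoint evaluation. -/
theorem Comp.multiEval (k : ℕ) (α : ℕ → R) {p : R[X]} (hp : p.degree < (2 ^ k : ℕ)) :
    Comp (Set.range α ∪ coeffSet p) (3000 * ((k + 1) ^ 2 * 2 ^ k))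
      ((fun i => p.eval (α i)) '' Set.Iio (2 ^ k)) := by
  rcases subsingleton_or_nontrivial R with hR | hR
  · refine (Comp.zero _).mono subset_rfl (fun x _ => Subsingleton.elim _ _) ?_
    have : 0 < (k + 1) ^ 2 * 2 ^ k := by positivity
    omega
  have hN := Nat.two_pow_pos k
  have e1 : 2 ^ (k + 1) = 2 ^ k + 2 ^ k := by ring
  set P := nodePoly k α
  set q := revPoly (2 ^ k) P with hq
  -- Reversal turns the leading coefficient of the monic `P` into the constant term, so the reversed
  -- polynomial is invertible as a power series.
  have hq0 : q.coeff 0 = 1 := by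
    have := (nodePoly_monic k α).coeff_natDegree
    rw [natDegree_nodePoly] at this
    rw [hq, revPoly, coeff_ofSeq, if_pos (by omega)]
    exact this
  obtain ⟨G, hG⟩ : ∃ G : PowerSeries R, (q : PowerSeries R) * G = 1 :=
    ⟨_, PowerSeries.mul_invOfUnit (q : PowerSeries R) 1 (by simpa using hq0)⟩
  set g : ℕ → R := fun n => if n + 1 < 2 ^ k then 0 else PowerSeries.coeff (n + 1 - 2 ^ k) G
    with hg
  set T := treeCoeffs k α
  set S := coeffSet (ofSeq (2 ^ (k + 1)) fun i => PowerSeries.coeff i G)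
  have hT : Comp (Set.range α ∪ coeffSet p) (90 * ((k + 1) ^ 2 * 2 ^ k)) T :=
    (Comp.tree k α).mono_left Set.subset_union_left
  have hS : Comp (Set.range α ∪ coeffSet p ∪ T) (400 * ((k + 1 + 1) * 2 ^ (k + 1))) S :=
    (Comp.powerSeriesInv hG hq0 (k + 1)).mono_left
      (((coeffSet_revPoly_subset _ _).trans (coeffSet_nodePoly_subset k α)).trans
        Set.subset_union_right)
  have hgS : g '' Set.Iio (2 ^ (k + 1)) ⊆ S := by
    rintro _ ⟨n, hn, rfl⟩
    rw [Set.mem_Iio] at hn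
    rw [hg]
    simp only
    split_ifs with h
    · exact zero_mem_coeffSet _
    · refine ⟨n + 1 - 2 ^ k, ?_⟩
      rw [coeff_ofSeq, if_pos (by omega)]
  -- `p` acts on the expansion of `1 / P` once, before the descent. The order of the commuting
  -- actions is chosen so that all nodes share this product and no division with remainder is
  -- needed.
  have hH : Comp (Set.range α ∪ coeffSet p ∪ (T ∪ S)) (mulCost (k + 1))
      (seqAct p g '' Set.Iio (2 ^ k)) :=
    Comp.polyAct (d := 2 ^ k - 1) (L := 2 ^ (k + 1)) (by rwa [show 2 ^ k - 1 + 1 = 2 ^ k by omega])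
      (by omega) (by omega) le_rfl
      (Set.subset_union_right.trans Set.subset_union_left)
      (hgS.trans (Set.subset_union_right.trans Set.subset_union_right))
  have hD : Comp (Set.range α ∪ coeffSet p ∪ (T ∪ S ∪ seqAct p g '' Set.Iio (2 ^ k))) _ _ :=
    Comp.treeDescent k α (seqAct p g)
      (Set.subset_union_left.trans (Set.subset_union_left.trans Set.subset_union_right))
      (Set.subset_union_right.trans Set.subset_union_right)
  refine (((hT.bind_keep hS).bind_keep hH).bind hD).mono subset_rfl ?_ ?_
  · rintro _ ⟨i, hi, rfl⟩
    exact ⟨i, hi, seqAct_coPoly_apply_zero k α hG hi⟩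
  · rw [mulCost, pow_succ 2 k]
    generalize 2 ^ k = E
    nlinarith [Nat.zero_le (E * k), Nat.zero_le (E * k ^ 2)]

end MultipointEvaluation

/-! ### Sums of simple fractions and Cauchy matrices -/

section Cauchy

open Polynomial

section Fractions

variable {R : Type*} [CommRing R]

/-- Numerator and denominator of the sum of the fractions `a i / b i`, for `i < 2 ^ k`. -/
noncomputable def fracSum : ℕ → (ℕ → R[X]) → (ℕ → R[X]) → R[X] × R[X]
  | 0, a, b => (a 0, b 0)
  | k + 1, a, b =>
    let u := fracSum k a b
    let v := fracSum k (fun i => a (2 ^ k + i)) (fun i => b (2 ^ k + i))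
    (u.1 * v.2 + v.1 * u.2, u.2 * v.2)

theorem degree_fracSum_lt (k : ℕ) (a b : ℕ → R[X]) (ha : ∀ i, (a i).degree < (2 : ℕ))
    (hb : ∀ i, (b i).degree < (2 : ℕ)) :
    (fracSum k a b).1.degree < (2 ^ k + 1 : ℕ) ∧ (fracSum k a b).2.degree < (2 ^ k + 1 : ℕ) := by
  induction k generalizing a b with
  | zero => exact ⟨ha 0, hb 0⟩
  | succ k ih =>
    obtain ⟨u1, u2⟩ := ih a b ha hb
    obtain ⟨v1, v2⟩ := ih (fun i => a (2 ^ k + i)) (fun i => b (2 ^ k + i)) (fun i => ha _)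
      fun i => hb _
    rw [pow_succ, mul_two]
    exact ⟨degree_add_lt (degree_mul_lt u1 v2) (degree_mul_lt v1 u2), degree_mul_lt u2 v2⟩

/-- `c i` plays the role of `a i / b i` at `x`. Stated without division, the identity holds in any
commutative ring, in particular in rings of functions. -/
theorem eval_fracSum (k : ℕ) (a b : ℕ → R[X]) (x : R) (c : ℕ → R)
    (h : ∀ i, (a i).eval x = (b i).eval x * c i) :
    (fracSum k a b).1.eval x = (fracSum k a b).2.eval x * ∑ i ∈ Finset.range (2 ^ k), c i := by
  induction k generalizing a b c with
  | zero => simpa [fracSum] using h 0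
  | succ k ih =>
    have h1 := ih a b c h
    have h2 := ih (fun i => a (2 ^ k + i)) (fun i => b (2 ^ k + i)) (fun i => c (2 ^ k + i))
      fun i => h _
    rw [pow_succ, mul_two, Finset.sum_range_add]
    simp only [fracSum, eval_add, eval_mul, h1, h2]
    ring

theorem isUnit_eval_fracSum (k : ℕ) (a b : ℕ → R[X]) (x : R) (h : ∀ i, IsUnit ((b i).eval x)) :
    IsUnit ((fracSum k a b).2.eval x) := by
  induction k generalizing a b with
  | zero => exact h 0
  | succ k ih =>
    simp only [fracSum, eval_mul]
    exact (ih a b h).mul (ih _ _ fun i => h _)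

variable [Algebra ℝ R]

theorem Comp.fracSum (k : ℕ) (a b : ℕ → R[X]) {A : Set R} (ha : ∀ i, (a i).degree < (2 : ℕ))
    (hb : ∀ i, (b i).degree < (2 : ℕ)) (hA : ∀ i, coeffSet (a i) ⊆ A)
    (hB : ∀ i, coeffSet (b i) ⊆ A) :
    Comp A (300 * ((k + 1) ^ 2 * 2 ^ k))
      (coeffSet (_root_.fracSum k a b).1 ∪ coeffSet (_root_.fracSum k a b).2) := by
  induction k generalizing a b with
  | zero => exact .done (Set.union_subset (hA 0) (hB 0))
  | succ k ih =>
    have hu := ih a b ha hb hA hB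
    have hv := ih (fun i => a (2 ^ k + i)) (fun i => b (2 ^ k + i)) (fun i => ha _)
      (fun i => hb _) (fun i => hA _) fun i => hB _
    obtain ⟨u1, u2⟩ := degree_fracSum_lt k a b ha hb
    obtain ⟨v1, v2⟩ := degree_fracSum_lt k (fun i => a (2 ^ k + i)) (fun i => b (2 ^ k + i))
      (fun i => ha _) fun i => hb _
    simp only [_root_.fracSum]
    set u := _root_.fracSum k a b
    set v := _root_.fracSum k (fun i => a (2 ^ k + i)) (fun i => b (2 ^ k + i))
    have hN := Nat.two_pow_pos k
    have hle : ((2 ^ k + 1 : ℕ) : WithBot ℕ) ≤ (2 ^ (k + 1) : ℕ) := by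
      exact_mod_cast (show 2 ^ k + 1 ≤ 2 ^ (k + 1) by rw [pow_succ]; omega)
    set B := coeffSet u.1 ∪ coeffSet u.2 ∪ (coeffSet v.1 ∪ coeffSet v.2)
    have m1 : Comp B (mulCost (k + 1)) (coeffSet (u.1 * v.2)) :=
      (Comp.polyMul (k + 1) (u1.trans_le hle) (v2.trans_le hle)).mono_left
        (Set.union_subset_union Set.subset_union_left Set.subset_union_right)
    have m2 : Comp B (mulCost (k + 1)) (coeffSet (v.1 * u.2)) :=
      (Comp.polyMul (k + 1) (v1.trans_le hle) (u2.trans_le hle)).mono_left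
        (Set.union_subset (Set.subset_union_left.trans Set.subset_union_right)
          (Set.subset_union_right.trans Set.subset_union_left))
    have m3 : Comp B (mulCost (k + 1)) (coeffSet (u.2 * v.2)) :=
      (Comp.polyMul (k + 1) (u2.trans_le hle) (v2.trans_le hle)).mono_left
        (Set.union_subset_union Set.subset_union_right Set.subset_union_right)
    have m4 := Comp.polyAdd (degree_mul_lt u1 v2) (degree_mul_lt v1 u2) m1 m2
    refine ((hu.union hv).trans (m4.union m3)).steps_le ?_
    rw [mulCost, pow_succ 2 k]
    generalize 2 ^ k = E at *
    nlinarith [Nat.zero_le (E * k)]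

/-- A bound for the cost of multiplying a Cauchy matrix of size at most `2 ^ k` with a vector. -/
def cauchyCost (k : ℕ) : ℕ := 60000 * ((k + 1) ^ 2 * 2 ^ k)

/-- The row sums are the values at `α i` of one rational function with poles among the `β j`. Its
numerator and denominator are evaluated at all `α i` together, and `n` divisions finish. `c`
supplies the inverses of the differences, whose existence makes the denominator a unit at each node.
-/
theorem Comp.cauchy {n k : ℕ} (hn : n ≤ 2 ^ k) (α β w : Fin n → R) (c : Fin n → Fin n → R)
    (hc : ∀ i j, (α i - β j) * c i j = 1) :
    Comp (Set.range α ∪ Set.range β ∪ Set.range w) (cauchyCost k)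
      (Set.range fun i => ∑ j, w j * c i j) := by
  set I := Set.range α ∪ Set.range β ∪ Set.range w with hI
  set α' : ℕ → R := fun i => if h : i < n then α ⟨i, h⟩ else 0 with hα'
  -- Padding to `2 ^ k` fractions uses `0 / 1`.
  set a : ℕ → R[X] := fun i => if h : i < n then C (w ⟨i, h⟩) else 0 with ha
  set b : ℕ → R[X] := fun i => if h : i < n then X - C (β ⟨i, h⟩) else 1 with hb
  set B : Set R := {0} ∪ {1} ∪ Set.range fun j => 0 - β j
  have hB : Comp I (1 + 1 + n * 2) B := by
    refine ((Comp.zero _).union (Comp.one _)).union (Comp.range fun j => ?_)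
    have hj : β j ∈ I := Or.inl (Or.inr ⟨j, rfl⟩)
    exact (Comp.zero _).sub (.of_mem hj)
  have da : ∀ i, (a i).degree < (2 : ℕ) := by
    intro i
    simp only [ha]
    split_ifs
    · exact degree_C_le.trans_lt (by exact_mod_cast two_pos)
    · rw [degree_zero]; exact WithBot.bot_lt_coe _
  have db : ∀ i, (b i).degree < (2 : ℕ) := by
    intro i
    simp only [hb]
    split_ifs
    · exact (degree_X_sub_C_le _).trans_lt (by exact_mod_cast one_lt_two)
    · exact degree_one_le.trans_lt (by exact_mod_cast two_pos)
  have cA : ∀ i, coeffSet (a i) ⊆ I ∪ B := by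
    rintro i _ ⟨l, rfl⟩
    simp only [ha]
    split_ifs with h
    · rw [coeff_C]
      split_ifs
      · exact Or.inl (Or.inr ⟨_, rfl⟩)
      · exact Or.inr (Or.inl (Or.inl rfl))
    · exact Or.inr (Or.inl (Or.inl (by simp)))
  have cB : ∀ i, coeffSet (b i) ⊆ I ∪ B := by
    rintro i _ ⟨l, rfl⟩
    right
    simp only [hb]
    split_ifs with h
    · rw [coeff_sub]
      match l with
      | 0 => exact Or.inr ⟨⟨i, h⟩, by simp⟩
      | 1 => exact Or.inl (Or.inr (by simp))
      | l + 2 => exact Or.inl (Or.inl (by simp [coeff_X]))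
    · rw [coeff_one]
      split_ifs
      · exact Or.inl (Or.inr rfl)
      · exact Or.inl (Or.inl rfl)
  have hF := hB.bind_keep (Comp.fracSum k a b da db cA cB)
  obtain ⟨d1, d2⟩ := degree_fracSum_lt k a b da db
  have heval := fun i => eval_fracSum k a b (α i)
    (fun j => if h : j < n then w ⟨j, h⟩ * c i ⟨j, h⟩ else 0) fun j => by
      simp only [ha, hb]
      split_ifs with h
      · simp only [eval_C, eval_sub, eval_X]
        linear_combination (-w ⟨j, h⟩) * hc i ⟨j, h⟩
      · simp
  have hunit := fun i => isUnit_eval_fracSum k a b (α i) fun j => by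
    simp only [hb]
    split_ifs with h
    · simp only [eval_C, eval_sub, eval_X]
      exact IsUnit.of_mul_eq_one _ (hc i ⟨j, h⟩)
    · simp
  have hsum : ∀ i, (∑ j ∈ Finset.range (2 ^ k), if h : j < n then w ⟨j, h⟩ * c i ⟨j, h⟩ else 0) =
      ∑ j, w j * c i j := by
    intro i
    rw [← Finset.sum_subset (Finset.range_subset_range.2 hn), Finset.sum_range]
    · simp
    · intro j _ hj
      rw [dif_neg (by simpa using hj)]
  simp only [hsum] at heval
  set u := (_root_.fracSum k a b).1
  set v := (_root_.fracSum k a b).2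
  have hN := Nat.two_pow_pos k
  have hle : ((2 ^ k + 1 : ℕ) : WithBot ℕ) ≤ (2 ^ (k + 1) : ℕ) := by
    exact_mod_cast (show 2 ^ k + 1 ≤ 2 ^ (k + 1) by rw [pow_succ]; omega)
  have hα : Set.range α' ⊆ I ∪ (B ∪ (coeffSet u ∪ coeffSet v)) := by
    rintro _ ⟨i, rfl⟩
    simp only [hα']
    split_ifs
    · exact Or.inl (Or.inl (Or.inl ⟨_, rfl⟩))
    · exact Or.inr (Or.inl (Or.inl (Or.inl rfl)))
  -- One size larger than `k`, because numerator and denominator are only known to have degree at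
  -- most `2 ^ k`.
  have e1 := (Comp.multiEval (k + 1) α' (d1.trans_le hle)).mono_left (Set.union_subset hα
    (Set.subset_union_left.trans (Set.subset_union_right.trans Set.subset_union_right)))
  have e2 := (Comp.multiEval (k + 1) α' (d2.trans_le hle)).mono_left (Set.union_subset hα
    (Set.subset_union_right.trans (Set.subset_union_right.trans Set.subset_union_right)))
  have e3 := hF.bind (e1.union e2)
  have hmem : ∀ (p : R[X]) (i : Fin n),
      p.eval (α i) ∈ (fun i => p.eval (α' i)) '' Set.Iio (2 ^ (k + 1)) := fun p i =>
    ⟨i, by rw [Set.mem_Iio, pow_succ]; omega, by simp [hα']⟩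
  have e4 := e3.trans (Comp.range (v := fun i => ∑ j, w j * c i j) (t := 1) fun i =>
    .of_op (.div (Or.inl (hmem u i)) (Or.inr (hmem v i)) (hunit i) (by rw [heval, mul_comm])))
  refine e4.steps_le ?_
  rw [cauchyCost, pow_succ 2 k]
  generalize 2 ^ k = E at *
  nlinarith [Nat.zero_le (E * k), Nat.zero_le (E * k ^ 2)]

end Fractions

/-- Multiplication with a diagonally scaled Cauchy matrix, all of whose parameters are inputs. -/
theorem Comp.scaledCauchy {D : Type} {n k : ℕ} (hn : n ≤ 2 ^ k) (s lam mu z a : Fin n → D → ℝ)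
    (h : ∀ i j d, lam i d ≠ mu j d) :
    Comp (Set.range s ∪ Set.range lam ∪ Set.range mu ∪ Set.range z ∪ Set.range a)
      (cauchyCost k + 2 * n)
      (Set.range fun i d => (Matrix.diagonal (fun i => z i d) *
        cauchyMatrix (fun i => lam i d) (fun i => mu i d) *
        Matrix.diagonal (fun i => a i d)).mulVec (fun j => s j d) i) := by
  set I := Set.range s ∪ Set.range lam ∪ Set.range mu ∪ Set.range z ∪ Set.range a
  have h1 : Comp I (n * 1) (Set.range fun j => a j * s j) :=
    Comp.range fun j => .of_op (.mul (Or.inr ⟨j, rfl⟩) (Or.inl (Or.inl (Or.inl (Or.inl ⟨j, rfl⟩)))))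
  have h2 := (Comp.cauchy hn lam mu (fun j => a j * s j)
    (fun i j d => 1 / (lam i d - mu j d)) fun i j => by
      ext d
      simp [sub_ne_zero.2 (h i j d)]).mono_left
    (A' := I ∪ Set.range fun j => a j * s j) (Set.union_subset_union_left _ (by
      refine Set.union_subset ?_ ?_
      · exact fun x hx => Or.inl (Or.inl (Or.inl (Or.inr hx)))
      · exact fun x hx => Or.inl (Or.inl (Or.inr hx))))
  have h3 := h1.bind h2
  refine (h3.bind (Comp.range (t := 1) fun i =>
    .of_op (.mul (Or.inl (Or.inl (Or.inr ⟨i, rfl⟩))) (Or.inr ⟨i, rfl⟩)))).mono subset_rfl ?_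
    (by omega)
  rintro _ ⟨i, rfl⟩
  refine ⟨i, funext fun d => ?_⟩
  simp only [Matrix.mulVec, dotProduct, Matrix.mul_diagonal, Matrix.diagonal_mul, cauchyMatrix,
    Matrix.of_apply, Pi.mul_apply, Finset.sum_apply, Finset.mul_sum]
  exact Finset.sum_congr rfl fun j _ => by ring

/-- The four parameter vectors are now fixed reals; loading them as constants accounts for the
additional `4 * n` steps. -/
theorem FastMul.scaledCauchy {n k : ℕ} (hn : n ≤ 2 ^ k) (lam mu z a : Fin n → ℝ)
    (h : ∀ i j, lam i ≠ mu j) :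
    FastMul (Matrix.diagonal z * cauchyMatrix lam mu * Matrix.diagonal a)
      (cauchyCost k + 6 * n) := by
  intro D s
  have hc : ∀ x : Fin n → ℝ, Comp (Set.range s) (n * 1) (Set.range fun i (_ : D) => x i) :=
    fun x => Comp.range fun i => Comp.const _ (x i)
  have h1 := Comp.scaledCauchy hn s (fun i _ => lam i) (fun i _ => mu i) (fun i _ => z i)
    (fun i _ => a i) fun i j _ => h i j
  refine ((((hc lam).union (hc mu)).union (hc z)).union (hc a)).bind
    (h1.mono_left ?_) |>.steps_le (by omega)
  simp only [Set.union_assoc]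
  exact subset_rfl

end Cauchy

/-! ### Eigenvector bases of rank-one updates -/

section RankOneUpdate

open Matrix

variable {n : ℕ}

theorem IsEigenbasis.conj {A X : Matrix (Fin n) (Fin n) ℝ} {mu : Fin n → ℝ}
    (h : IsEigenbasis A X mu) {W : Matrix (Fin n) (Fin n) ℝ}
    (hW : W ∈ Matrix.orthogonalGroup (Fin n) ℝ) : IsEigenbasis (W * A * Wᵀ) (W * X) mu := by
  refine ⟨mul_mem hW h.1, ?_⟩
  rw [h.2, Matrix.transpose_mul]
  simp only [Matrix.mul_assoc]

theorem transpose_mem_orthogonalGroup {W : Matrix (Fin n) (Fin n) ℝ}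
    (hW : W ∈ Matrix.orthogonalGroup (Fin n) ℝ) : Wᵀ ∈ Matrix.orthogonalGroup (Fin n) ℝ :=
  Unitary.star_mem hW

theorem mul_transpose_of_orthogonal {W : Matrix (Fin n) (Fin n) ℝ}
    (hW : W ∈ Matrix.orthogonalGroup (Fin n) ℝ) : W * Wᵀ = 1 :=
  (Matrix.mem_orthogonalGroup_iff (Fin n) ℝ).1 hW

theorem transpose_mul_of_orthogonal {W : Matrix (Fin n) (Fin n) ℝ}
    (hW : W ∈ Matrix.orthogonalGroup (Fin n) ℝ) : Wᵀ * W = 1 :=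
  (Matrix.mem_orthogonalGroup_iff' (Fin n) ℝ).1 hW

theorem conj_rankOneUpdate (W A : Matrix (Fin n) (Fin n) ℝ) (v : Fin n → ℝ) (ρ : ℝ) :
    W * rankOneUpdate A v ρ * Wᵀ = rankOneUpdate (W * A * Wᵀ) (W *ᵥ v) ρ := by
  rw [rankOneUpdate, rankOneUpdate, mul_add, add_mul, Matrix.mul_smul, Matrix.smul_mul,
    Matrix.mul_vecMulVec, Matrix.vecMulVec_mul, Matrix.vecMul_transpose]

theorem IsEigenbasis.rankOneUpdate_diagonal {L U X : Matrix (Fin n) (Fin n) ℝ}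
    {lam mu v : Fin n → ℝ} {ρ : ℝ} (hL : IsEigenbasis L U lam)
    (hX : IsEigenbasis (rankOneUpdate L v ρ) X mu) :
    IsEigenbasis (rankOneUpdate (diagonal lam) (Uᵀ *ᵥ v) ρ) (Uᵀ * X) mu := by
  have h := hX.conj (transpose_mem_orthogonalGroup hL.1)
  have e : Uᵀ * L * Uᵀᵀ = diagonal lam := by
    have := transpose_mul_of_orthogonal hL.1
    rw [Matrix.transpose_transpose]
    calc Uᵀ * L * U = Uᵀ * (U * diagonal lam * Uᵀ) * U := by rw [← hL.2]
      _ = (Uᵀ * U) * diagonal lam * (Uᵀ * U) := by simp only [Matrix.mul_assoc]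
      _ = diagonal lam := by rw [this, one_mul, mul_one]
  rwa [conj_rankOneUpdate, e] at h

theorem IsEigenbasis.rankOneUpdate_of_diagonal {L U Y : Matrix (Fin n) (Fin n) ℝ}
    {lam mu v : Fin n → ℝ} {ρ : ℝ} (hL : IsEigenbasis L U lam)
    (hY : IsEigenbasis (rankOneUpdate (diagonal lam) (Uᵀ *ᵥ v) ρ) Y mu) :
    IsEigenbasis (rankOneUpdate L v ρ) (U * Y) mu := by
  have h := hY.conj hL.1
  rwa [conj_rankOneUpdate, ← hL.2, Matrix.mulVec_mulVec, mul_transpose_of_orthogonal hL.1,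
    Matrix.one_mulVec] at h

theorem IsEigenbasis.mul_eq {A X : Matrix (Fin n) (Fin n) ℝ} {mu : Fin n → ℝ}
    (h : IsEigenbasis A X mu) : A * X = X * diagonal mu := by
  rw [h.2, Matrix.mul_assoc, transpose_mul_of_orthogonal h.1, mul_one]

theorem isEigenbasis_of_mul_eq {A X : Matrix (Fin n) (Fin n) ℝ} {mu : Fin n → ℝ}
    (hX : X ∈ Matrix.orthogonalGroup (Fin n) ℝ) (h : A * X = X * diagonal mu) :
    IsEigenbasis A X mu := by
  refine ⟨hX, ?_⟩
  rw [← h, Matrix.mul_assoc, mul_transpose_of_orthogonal hX, mul_one]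

theorem exists_isEigenbasis {A : Matrix (Fin n) (Fin n) ℝ} (hA : A.IsHermitian) :
    ∃ X mu, IsEigenbasis A X mu := by
  refine ⟨hA.eigenvectorUnitary, hA.eigenvalues, hA.eigenvectorUnitary.2, ?_⟩
  exact hA.spectral_theorem

theorem exists_ne_zero_of_orthogonal {X : Matrix (Fin n) (Fin n) ℝ}
    (hX : X ∈ Matrix.orthogonalGroup (Fin n) ℝ) (j : Fin n) : ∃ i, X i j ≠ 0 := by
  by_contra! h
  have := congrFun (congrFun (transpose_mul_of_orthogonal hX) j) j
  simp [Matrix.mul_apply, h] at this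

/-- The eigenvector equation for the update of a diagonal matrix, entrywise. -/
theorem IsEigenbasis.entry {Y : Matrix (Fin n) (Fin n) ℝ} {lam mu z : Fin n → ℝ} {ρ : ℝ}
    (h : IsEigenbasis (rankOneUpdate (diagonal lam) z ρ) Y mu) (i j : Fin n) :
    (lam i - mu j) * Y i j = z i * (-ρ * ∑ k, z k * Y k j) := by
  have := congrFun (congrFun h.mul_eq i) j
  rw [rankOneUpdate, add_mul, Matrix.add_apply, Matrix.diagonal_mul, Matrix.mul_diagonal,
    Matrix.smul_mul, Matrix.smul_apply, Matrix.vecMulVec_mul, Matrix.vecMulVec_apply] at this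
  simp only [Matrix.vecMul, dotProduct, smul_eq_mul] at this
  linarith

/-- A coincidence `lam i = mu j` forces `⟨z, Y_j⟩ = 0` by the equation in row `i`. The other rows
then give `Y k j = 0` for `k ≠ i`, and `⟨z, Y_j⟩ = 0` removes the last entry: a zero column in an
orthogonal matrix. -/
theorem IsEigenbasis.ne_of_weight_ne_zero {Y : Matrix (Fin n) (Fin n) ℝ} {lam mu z : Fin n → ℝ}
    {ρ : ℝ} (h : IsEigenbasis (rankOneUpdate (diagonal lam) z ρ) Y mu)
    (hlam : Function.Injective lam) (hρ : ρ ≠ 0) (hz : ∀ i, z i ≠ 0) (i j : Fin n) :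
    lam i ≠ mu j := by
  intro hij
  have hc : ∑ k, z k * Y k j = 0 := by
    have := h.entry i j
    rw [hij, sub_self, zero_mul] at this
    simpa [hz i, hρ] using this.symm
  have h0 : ∀ k, k ≠ i → Y k j = 0 := by
    intro k hk
    have := h.entry k j
    rw [hc, mul_zero, mul_zero, ← hij] at this
    exact (mul_eq_zero.1 this).resolve_left (sub_ne_zero.2 (hlam.ne hk))
  rw [Finset.sum_eq_single i (fun k _ hk => by rw [h0 k hk, mul_zero]) (by simp)] at hc
  obtain ⟨k, hk⟩ := exists_ne_zero_of_orthogonal h.1 j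
  by_cases hki : k = i
  · subst hki
    exact hk ((mul_eq_zero.1 hc).resolve_left (hz k))
  · exact hk (h0 k hki)

theorem IsEigenbasis.eq_scaledCauchy {Y : Matrix (Fin n) (Fin n) ℝ} {lam mu z : Fin n → ℝ}
    {ρ : ℝ} (h : IsEigenbasis (rankOneUpdate (diagonal lam) z ρ) Y mu)
    (hne : ∀ i j, lam i ≠ mu j) :
    Y = diagonal z * cauchyMatrix lam mu * diagonal fun j => -ρ * ∑ k, z k * Y k j := by
  ext i j
  rw [Matrix.mul_diagonal, Matrix.diagonal_mul, cauchyMatrix, Matrix.of_apply]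
  have h1 := h.entry i j
  have h2 : lam i - mu j ≠ 0 := sub_ne_zero.2 (hne i j)
  field_simp
  linarith

/-- If the old or the new eigenvalues are distinct, every eigenvector basis of the update of a
diagonal matrix is a Cauchy-like matrix up to at most `n` entries. -/
theorem IsEigenbasis.fastMul {Y : Matrix (Fin n) (Fin n) ℝ} {lam mu z : Fin n → ℝ} {ρ : ℝ}
    (h : IsEigenbasis (rankOneUpdate (diagonal lam) z ρ) Y mu)
    (hinj : Function.Injective lam ∨ Function.Injective mu) {k : ℕ} (hk : n ≤ 2 ^ k) :
    FastMul Y (cauchyCost k + 10 * n + 1) := by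
  classical
  set a : Fin n → ℝ := fun j => -ρ * ∑ k, z k * Y k j with ha
  have hent : ∀ i j, (lam i - mu j) * Y i j = z i * a j := h.entry
  obtain ⟨B, hB⟩ : ∃ B, ∀ i, lam i < B ∧ mu i < B := by
    obtain ⟨B₁, h₁⟩ := (Set.finite_range lam).bddAbove
    obtain ⟨B₂, h₂⟩ := (Set.finite_range mu).bddAbove
    refine ⟨max B₁ B₂ + 1, fun i => ⟨?_, ?_⟩⟩
    · exact ((h₁ ⟨i, rfl⟩).trans (le_max_left _ _)).trans_lt (lt_add_one _)
    · exact ((h₂ ⟨i, rfl⟩).trans (le_max_right _ _)).trans_lt (lt_add_one _)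
  -- Row `i` of the scaled Cauchy matrix is zero when `z i = 0`, column `j` when `a j = 0`. The
  -- parameters there are free and are moved to `B` and `B + 1`, beyond both spectra. At every
  -- remaining pair `z i * a j ≠ 0`, which excludes a coincidence.
  set lam' : Fin n → ℝ := fun i => if z i = 0 then B else lam i with hlam'
  set mu' : Fin n → ℝ := fun j => if a j = 0 then B + 1 else mu j with hmu'
  have hne : ∀ i j, lam' i ≠ mu' j := by
    intro i j hij
    have h1 := (hB i).1
    have h2 := (hB j).2
    simp only [hlam', hmu'] at hij
    split_ifs at hij with hz ha
    · linarith
    · linarith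
    · linarith
    · have := hent i j
      rw [hij, sub_self, zero_mul] at this
      exact mul_ne_zero hz ‹_› this.symm
  set E : Matrix (Fin n) (Fin n) ℝ := Matrix.of fun i j => if lam i = mu j then Y i j else 0 with hE
  have hY : Y = diagonal z * cauchyMatrix lam' mu' * diagonal a + E := by
    ext i j
    rw [Matrix.add_apply, Matrix.mul_diagonal, Matrix.diagonal_mul, cauchyMatrix, Matrix.of_apply,
      hE, Matrix.of_apply]
    have h1 := hent i j
    split_ifs with hij
    · rw [hij, sub_self, zero_mul] at h1
      rcases mul_eq_zero.1 h1.symm with h0 | h0 <;> simp [h0]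
    · have h2 := sub_ne_zero.2 hij
      have h3 : Y i j = z i * a j / (lam i - mu j) := by field_simp; linarith
      by_cases hz : z i = 0
      · simp [h3, hz]
      by_cases ha0 : a j = 0
      · simp [h3, ha0]
      rw [h3]
      simp only [hlam', hmu', if_neg hz, if_neg ha0]
      ring
  set P : Finset (Fin n × Fin n) := Finset.univ.filter fun p => lam p.1 = mu p.2
  -- If `lam` is injective, each column contains at most one coincidence; if `mu` is, each row does.
  have hP : P.card ≤ n := by
    suffices P.card ≤ (Finset.univ : Finset (Fin n)).card by simpa using this
    rcases hinj with hi | hi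
    · refine Finset.card_le_card_of_injOn Prod.snd (fun _ _ => Finset.mem_coe.2 (Finset.mem_univ _)) ?_
      rintro ⟨i, j⟩ hp ⟨i', j'⟩ hp' hj
      simp only [P, Finset.coe_filter, Finset.mem_univ, true_and, Set.mem_ofPred_eq] at hp hp' hj
      subst hj
      rw [hi (hp.trans hp'.symm)]
    · refine Finset.card_le_card_of_injOn Prod.fst (fun _ _ => Finset.mem_coe.2 (Finset.mem_univ _)) ?_
      rintro ⟨i, j⟩ hp ⟨i', j'⟩ hp' hj
      simp only [P, Finset.coe_filter, Finset.mem_univ, true_and, Set.mem_ofPred_eq] at hp hp' hj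
      subst hj
      rw [hi (hp.symm.trans hp')]
  have hEfast : FastMul E (1 + 3 * P.card) := FastMul.of_sparse E P fun i j hij => by
    simp only [P, Finset.mem_filter, Finset.mem_univ, true_and]
    by_contra h0
    exact hij (by simp [hE, h0])
  rw [hY]
  exact ((FastMul.scaledCauchy hk lam' mu' z a hne).add hEfast).mono (by omega)

theorem rankOneUpdate_diagonal_isHermitian (lam z : Fin n → ℝ) (ρ : ℝ) :
    (rankOneUpdate (diagonal lam) z ρ).IsHermitian := by
  ext i j
  simp only [rankOneUpdate, Matrix.conjTranspose_apply, Matrix.add_apply, Matrix.smul_apply,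
    Matrix.vecMulVec_apply, Matrix.diagonal_apply, star_trivial, smul_eq_mul]
  by_cases hij : i = j
  · subst hij; rfl
  · rw [if_neg hij, if_neg (Ne.symm hij)]; ring

/-- If the old eigenvalues are distinct on the support of the weights, some eigenvector basis of
the update of a diagonal matrix admits fast multiplication. -/
theorem exists_fastMul_of_injOn (lam z : Fin n → ℝ) (ρ : ℝ)
    (hinj : ∀ i j, z i ≠ 0 → z j ≠ 0 → lam i = lam j → i = j) {k : ℕ} (hk : n ≤ 2 ^ k) :
    ∃ Y mu, IsEigenbasis (rankOneUpdate (diagonal lam) z ρ) Y mu ∧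
      FastMul Y (cauchyCost k + 10 * n + 1) := by
  classical
  set N := ∑ k, z k ^ 2
  have hN : 0 ≤ N := Finset.sum_nonneg fun _ _ => sq_nonneg _
  -- `|ρ| * N` is the norm of `ρ z zᵀ`, so `B` exceeds every eigenvalue the update can produce on
  -- the support of `z`.
  obtain ⟨B, hB⟩ : ∃ B, ∀ i, lam i + |ρ| * N < B := by
    obtain ⟨B, h⟩ := (Set.finite_range lam).bddAbove
    exact ⟨B + |ρ| * N + 1, fun i => by linarith [h ⟨i, rfl⟩]⟩
  have hρN : 0 ≤ |ρ| * N := mul_nonneg (abs_nonneg _) hN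
  set lam' : Fin n → ℝ := fun i => if z i = 0 then B + (i : ℕ) else lam i with hlam'
  have hcast : ∀ i : Fin n, (0 : ℝ) ≤ ((i : ℕ) : ℝ) := fun i => Nat.cast_nonneg _
  have hlam'inj : Function.Injective lam' := by
    intro i j hij
    simp only [hlam'] at hij
    split_ifs at hij with hi hj hj
    · exact Fin.ext (by exact_mod_cast add_left_cancel hij)
    · linarith [hB j, hcast i]
    · linarith [hB i, hcast j]
    · exact hinj i j hi hj hij
  obtain ⟨Y, mu', hY⟩ := exists_isEigenbasis (rankOneUpdate_diagonal_isHermitian lam' z ρ)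
  have hfast := hY.fastMul (Or.inl hlam'inj) hk
  -- A column that meets a coordinate of weight zero is concentrated there: its eigenvalue is `B +
  -- i`, different from the other displaced values and too large for the block on the support of
  -- `z`.
  have key : ∀ i j, z i = 0 → Y i j ≠ 0 → ∀ k, k ≠ i → Y k j = 0 := by
    intro i j hi hij
    have hmu : mu' j = B + (i : ℕ) := by
      have := hY.entry i j
      rw [hi, zero_mul] at this
      have := (mul_eq_zero.1 this).resolve_right hij
      simp only [hlam', if_pos hi] at this
      linarith
    have hsupp : ∀ k, z k ≠ 0 → Y k j = 0 := by
      set S := Finset.univ.filter fun k => z k ≠ 0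
      set c := ∑ k, z k * Y k j with hc
      have hcS : c = ∑ k ∈ S, z k * Y k j := by
        rw [hc, Finset.sum_filter]
        refine Finset.sum_congr rfl fun k _ => ?_
        split_ifs with h
        · rfl
        · rw [not_not.1 h, zero_mul]
      -- Rayleigh quotient on the support: this identity and Cauchy–Schwarz bound `∑ (mu' j - lam k)
      -- Y k j ²` by `|ρ| N ∑ Y k j ²`, while every `mu' j - lam k` exceeds `|ρ| N`.
      have h1 : ∑ k ∈ S, (mu' j - lam k) * Y k j ^ 2 = ρ * c ^ 2 := by
        rw [pow_two c, ← mul_assoc]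
        nth_rewrite 2 [hcS]
        rw [Finset.mul_sum]
        refine Finset.sum_congr rfl fun k hk => ?_
        have hk : z k ≠ 0 := (Finset.mem_filter.1 hk).2
        have h2 := hY.entry k j
        simp only [hlam', if_neg hk] at h2
        linear_combination (-Y k j) * h2
      have h2 : c ^ 2 ≤ N * ∑ k ∈ S, Y k j ^ 2 := by
        rw [hcS]
        refine (Finset.sum_mul_sq_le_sq_mul_sq S _ _).trans ?_
        refine mul_le_mul_of_nonneg_right ?_ (Finset.sum_nonneg fun _ _ => sq_nonneg _)
        exact Finset.sum_le_sum_of_subset_of_nonneg (Finset.subset_univ _)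
          fun _ _ _ => sq_nonneg _
      have h3 : ∑ k ∈ S, (mu' j - lam k - |ρ| * N) * Y k j ^ 2 ≤ 0 := by
        have : ρ * c ^ 2 ≤ |ρ| * (N * ∑ k ∈ S, Y k j ^ 2) :=
          (mul_le_mul_of_nonneg_right (le_abs_self ρ) (sq_nonneg c)).trans
            (mul_le_mul_of_nonneg_left h2 (abs_nonneg ρ))
        simp only [sub_mul _ (|ρ| * N), Finset.sum_sub_distrib, h1, ← Finset.mul_sum]
        linarith
      have hpos : ∀ k, 0 < mu' j - lam k - |ρ| * N := fun k => by
        rw [hmu]; linarith [hB k, hcast i]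
      have h4 := (Finset.sum_eq_zero_iff_of_nonneg fun k _ =>
        mul_nonneg (hpos k).le (sq_nonneg (Y k j))).1
          (le_antisymm h3 (Finset.sum_nonneg fun k _ =>
            mul_nonneg (hpos k).le (sq_nonneg (Y k j))))
      intro k hk
      have := h4 k (Finset.mem_filter.2 ⟨Finset.mem_univ _, hk⟩)
      exact pow_eq_zero_iff two_ne_zero |>.1 ((mul_eq_zero.1 this).resolve_left (hpos k).ne')
    intro k hki
    by_cases hzk : z k = 0
    · have h1 := hY.entry k j
      rw [hzk, zero_mul] at h1
      refine (mul_eq_zero.1 h1).resolve_left ?_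
      have : mu' j = lam' i := by rw [hmu]; simp only [hlam', if_pos hi]
      rw [this]
      exact sub_ne_zero.2 (hlam'inj.ne hki)
    · exact hsupp k hzk
  -- By `key`, each column is either concentrated at one displaced coordinate or supported where
  -- `lam' = lam`. On it the displacement `diagonal (lam' - lam)` acts as a scalar `nu j`, so
  -- undoing the displacement keeps the eigenvectors and shifts `mu' j` by `nu j`.
  have hnu : ∀ j, ∃ nu : ℝ, ∀ i, (lam' i - lam i) * Y i j = Y i j * nu := by
    intro j
    by_cases hj : ∃ i, z i = 0 ∧ Y i j ≠ 0
    · obtain ⟨i, hi, hij⟩ := hj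
      refine ⟨lam' i - lam i, fun k => ?_⟩
      by_cases hki : k = i
      · rw [hki, mul_comm]
      · rw [key i j hi hij k hki, mul_zero, zero_mul]
    · push Not at hj
      refine ⟨0, fun i => ?_⟩
      by_cases hi : z i = 0
      · rw [hj i hi, mul_zero, zero_mul]
      · simp [hlam', if_neg hi]
  choose nu hnu using hnu
  refine ⟨Y, fun j => mu' j - nu j, isEigenbasis_of_mul_eq hY.1 ?_, hfast⟩
  have hA : rankOneUpdate (diagonal lam) z ρ =
      rankOneUpdate (diagonal lam') z ρ - diagonal fun i => lam' i - lam i := by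
    rw [rankOneUpdate, rankOneUpdate, ← Matrix.diagonal_sub]
    abel
  rw [hA, sub_mul, hY.mul_eq]
  ext i j
  rw [Matrix.sub_apply, Matrix.mul_diagonal, Matrix.diagonal_mul, Matrix.mul_diagonal, hnu]
  ring

/-- Householder reflections in the eigenspaces of a diagonal matrix concentrate a vector in one
coordinate per eigenvalue. -/
theorem exists_householder (lam z : Fin n → ℝ) :
    ∃ H : Matrix (Fin n) (Fin n) ℝ, IsEigenbasis (diagonal lam) H lam ∧
      (∀ i j, (Hᵀ *ᵥ z) i ≠ 0 → (Hᵀ *ᵥ z) j ≠ 0 → lam i = lam j → i = j) ∧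
      FastMul H (10 * n + 3) := by
  classical
  -- One representative index per eigenvalue. `r` is the norm of `z` within the block, and `w` is
  -- the Householder vector sending that block of `z` to `r` times the representative's basis
  -- vector.
  set rep : Fin n → Fin n := fun i => Set.rangeSplitting lam ⟨lam i, i, rfl⟩ with hrep
  have hlr : ∀ i, lam (rep i) = lam i := fun i => Set.apply_rangeSplitting lam _
  have hreq : ∀ i j, rep i = rep j ↔ lam i = lam j := by
    intro i j
    refine ⟨fun h => by rw [← hlr i, h, hlr], fun h => ?_⟩
    simp only [hrep, h]
  set r : Fin n → ℝ := fun i => √(∑ k, if rep k = rep i then z k ^ 2 else 0) with hr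
  set w : Fin n → ℝ := fun i => z i - if rep i = i then r i else 0 with hw
  set N : Fin n → ℝ := fun i => ∑ k, if rep k = rep i then w k ^ 2 else 0 with hN
  have hrcongr : ∀ i j, rep i = rep j → r i = r j := fun i j h => by simp only [hr, h]
  have hNcongr : ∀ i j, rep i = rep j → N i = N j := fun i j h => by simp only [hN, h]
  have hrr : ∀ i, rep (rep i) = rep i := fun i => (hreq _ _).2 (hlr i)
  -- Within a block `|w|² = 2 ⟨w, z⟩`, because `z` and its target have the same norm.
  have hNz : ∀ i, N i = 2 * ∑ k, if rep k = rep i then w k * z k else 0 := by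
    intro i
    have h1 : ∀ k, (if rep k = rep i then w k ^ 2 else 0) =
        2 * (if rep k = rep i then w k * z k else 0) -
        (if rep k = rep i then z k ^ 2 else 0) + if k = rep i then r i ^ 2 else 0 := by
      intro k
      by_cases hk : rep k = rep i
      · simp only [if_pos hk, hw]
        by_cases hk' : k = rep i
        · rw [if_pos hk', if_pos (hk.trans hk'.symm), hrcongr k i hk]; ring
        · rw [if_neg hk', if_neg (fun h => hk' (h.symm.trans hk))]; ring
      · rw [if_neg hk, if_neg hk, if_neg hk, if_neg (fun h => hk (by rw [h, hrr]))]; ring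
    have h2 : r i ^ 2 = ∑ k, if rep k = rep i then z k ^ 2 else 0 :=
      Real.sq_sqrt (Finset.sum_nonneg fun k _ => by split_ifs <;> positivity)
    simp only [hN]
    rw [Finset.sum_congr rfl fun k _ => h1 k, Finset.sum_add_distrib, Finset.sum_sub_distrib,
      ← Finset.mul_sum, Finset.sum_ite_eq' Finset.univ (rep i), if_pos (Finset.mem_univ _), h2]
    ring
  have hw0 : ∀ i, N i = 0 → w i = 0 := by
    intro i hi
    have := (Finset.sum_eq_zero_iff_of_nonneg fun k _ => by split_ifs <;> positivity).1 hi i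
      (Finset.mem_univ _)
    simpa using this
  -- `1 - G` is the reflection in each block. Where `w` vanishes on a block, division by `N i = 0`
  -- yields 0 and the reflection becomes the identity.
  set G : Matrix (Fin n) (Fin n) ℝ :=
    Matrix.of fun i j => if rep i = rep j then 2 * w i * w j / N i else 0 with hG
  have hGT : Gᵀ = G := by
    ext i j
    simp only [hG, Matrix.transpose_apply, Matrix.of_apply]
    by_cases h : rep i = rep j
    · rw [if_pos h, if_pos h.symm, hNcongr i j h]; ring
    · rw [if_neg h, if_neg (Ne.symm h)]
  have hGG : G * G = 2 • G := by
    ext i j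
    rw [Matrix.mul_apply, Matrix.smul_apply]
    simp only [hG, Matrix.of_apply]
    by_cases h : rep i = rep j
    · rw [if_pos h]
      have : ∀ k, (if rep i = rep k then 2 * w i * w k / N i else 0) *
          (if rep k = rep j then 2 * w k * w j / N k else 0) =
          (4 * w i * w j / N i ^ 2) * if rep k = rep i then w k ^ 2 else 0 := by
        intro k
        by_cases hk : rep k = rep i
        · rw [if_pos hk, if_pos hk.symm, if_pos (hk.trans h), hNcongr k i hk]; ring
        · rw [if_neg hk, if_neg (Ne.symm hk)]; ring
      rw [Finset.sum_congr rfl fun k _ => this k, ← Finset.mul_sum]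
      change _ * N i = _
      by_cases hi : N i = 0
      · simp [hi]
      · simp only [nsmul_eq_mul]; field_simp; push_cast; ring
    · rw [if_neg h, smul_zero]
      refine Finset.sum_eq_zero fun k _ => ?_
      by_cases hk : rep i = rep k
      · rw [if_neg (fun h' => h (hk.trans h')), mul_zero]
      · rw [if_neg hk, zero_mul]
  have hGz : ∀ i, (G *ᵥ z) i = w i := by
    intro i
    simp only [Matrix.mulVec, dotProduct, hG, Matrix.of_apply]
    have : ∀ k, (if rep i = rep k then 2 * w i * w k / N i else 0) * z k =
        (2 * w i / N i) * if rep k = rep i then w k * z k else 0 := by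
      intro k
      by_cases hk : rep k = rep i
      · rw [if_pos hk, if_pos hk.symm]; ring
      · rw [if_neg hk, if_neg (Ne.symm hk)]; ring
    rw [Finset.sum_congr rfl fun k _ => this k, ← Finset.mul_sum]
    by_cases hi : N i = 0
    · rw [hw0 i hi]; simp
    · have h1 := hNz i
      have : 2 * w i / N i * (∑ k, if rep k = rep i then w k * z k else 0) =
        w i * (2 * (∑ k, if rep k = rep i then w k * z k else 0)) / N i := by ring
      rw [this, ← h1, mul_div_assoc, div_self hi, mul_one]
  have hHT : (1 - G)ᵀ = 1 - G := by rw [Matrix.transpose_sub, hGT, Matrix.transpose_one]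
  have hHH : (1 - G) * (1 - G) = 1 := by
    rw [sub_mul, mul_sub, mul_sub, hGG, one_mul, mul_one, one_mul, two_smul]
    abel
  have hHz : ∀ i, ((1 - G)ᵀ *ᵥ z) i = if rep i = i then r i else 0 := by
    intro i
    rw [hHT, Matrix.sub_mulVec, Matrix.one_mulVec, Pi.sub_apply, hGz]
    simp [hw]
  refine ⟨1 - G, isEigenbasis_of_mul_eq ?_ ?_, fun i j hi hj hij => ?_, ?_⟩
  · rw [Matrix.mem_orthogonalGroup_iff]
    rw [hHT, hHH]
  · rw [mul_sub, sub_mul, mul_one, one_mul]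
    congr 1
    ext i j
    rw [Matrix.diagonal_mul, Matrix.mul_diagonal]
    simp only [hG, Matrix.of_apply]
    split_ifs with h
    · rw [(hreq i j).1 h, mul_comm]
    · simp
  · rw [hHz] at hi hj
    have h1 : rep i = i := by by_contra h; simp [h] at hi
    have h2 : rep j = j := by by_contra h; simp [h] at hj
    rw [← h1, ← h2]
    exact (hreq i j).2 hij
  -- `G` has rank at most one on each block: `C` collects the inner product with `w` at the
  -- representative and `B` distributes it, each with at most `n` nonzero entries.
  · set B : Matrix (Fin n) (Fin n) ℝ :=
      Matrix.of fun i k => if rep i = k then -(2 * w i / N i) else 0 with hB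
    set C : Matrix (Fin n) (Fin n) ℝ := Matrix.of fun k j => if rep j = k then w j else 0 with hC
    have hBC : 1 - G = 1 + B * C := by
      rw [sub_eq_add_neg]
      congr 1
      ext i j
      rw [Matrix.neg_apply, Matrix.mul_apply]
      simp only [hB, hC, hG, Matrix.of_apply, ite_mul, zero_mul]
      rw [Finset.sum_ite_eq, if_pos (Finset.mem_univ _)]
      by_cases h : rep i = rep j
      · rw [if_pos h, if_pos h.symm]; ring
      · rw [if_neg h, if_neg (Ne.symm h)]; ring
    have f1 : FastMul (1 : Matrix (Fin n) (Fin n) ℝ) (1 + 3 * n) :=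
      (FastMul.of_sparse _ (Finset.univ.image fun i => (i, i)) fun i j hij => by
        have : i = j := by by_contra h; exact hij (Matrix.one_apply_ne h)
        simp [this]).mono (by
          have := Finset.card_image_le (s := Finset.univ) (f := fun i : Fin n => (i, i))
          simp only [Finset.card_univ, Fintype.card_fin] at this
          omega)
    have f2 : FastMul B (1 + 3 * n) :=
      (FastMul.of_sparse _ (Finset.univ.image fun i => (i, rep i)) fun i j hij => by
        have : rep i = j := by by_contra h; exact hij (by simp [hB, h])
        simp [this]).mono (by
          have := Finset.card_image_le (s := Finset.univ) (f := fun i : Fin n => (i, rep i))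
          simp only [Finset.card_univ, Fintype.card_fin] at this
          omega)
    have f3 : FastMul C (1 + 3 * n) :=
      (FastMul.of_sparse _ (Finset.univ.image fun j => (rep j, j)) fun i j hij => by
        have : rep j = i := by by_contra h; exact hij (by simp [hC, h])
        simp [this]).mono (by
          have := Finset.card_image_le (s := Finset.univ) (f := fun i : Fin n => (rep i, i))
          simp only [Finset.card_univ, Fintype.card_fin] at this
          omega)
    rw [hBC]
    exact (f1.add (f2.mul f3)).mono (by omega)

theorem exists_fastMul_rankOneUpdate_diagonal (lam z : Fin n → ℝ) (ρ : ℝ) {k : ℕ}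
    (hk : n ≤ 2 ^ k) :
    ∃ Y mu, IsEigenbasis (rankOneUpdate (diagonal lam) z ρ) Y mu ∧
      FastMul Y (cauchyCost k + 20 * n + 4) := by
  obtain ⟨H, hH, hinj, hfast⟩ := exists_householder lam z
  obtain ⟨Y, mu, hY, hYfast⟩ := exists_fastMul_of_injOn lam (Hᵀ *ᵥ z) ρ hinj hk
  exact ⟨H * Y, mu, hH.rankOneUpdate_of_diagonal hY, (hfast.mul hYfast).mono (by omega)⟩

end RankOneUpdate

/-! ### Total cost and assembly -/

theorem isBigO_cost {f : ℕ → ℝ} (hf : ∀ n, 0 ≤ f n) {t : ℕ → ℕ}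
    (ht : (fun n => (t n : ℝ)) =O[Filter.atTop] f) :
    (fun n => ((cauchyCost (Nat.clog 2 n) + 20 * n + 4 + (t n + 1) : ℕ) : ℝ)) =O[Filter.atTop]
      (fun n : ℕ => (n : ℝ) * Real.log n ^ 2 + f n) := by
  obtain ⟨C, hC⟩ := ht.bound
  -- The Cauchy part contributes `60000 * 72` times `n log² n`; the linear and constant terms fit
  -- into the remaining margin. `C` takes care of `t n`.
  refine Asymptotics.IsBigO.of_bound (max C 5000000) ?_
  filter_upwards [hC, Filter.eventually_ge_atTop 2] with n hn hn2
  have hn2' : (2 : ℝ) ≤ n := by exact_mod_cast hn2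
  have hlog2 : (1 / 2 : ℝ) < Real.log 2 := by linarith [Real.log_two_gt_d9]
  have hlog : Real.log 2 ≤ Real.log n := Real.log_le_log two_pos hn2'
  obtain ⟨K, hK⟩ : ∃ K, Nat.clog 2 n = K + 1 :=
    ⟨Nat.clog 2 n - 1, by have := Nat.clog_pos one_lt_two hn2; omega⟩
  have hpow : 2 ^ K < n := by
    have := Nat.pow_pred_clog_lt_self one_lt_two (x := n) (by omega)
    rwa [hK] at this
  have hpow' : (2 : ℝ) ^ K ≤ n := by exact_mod_cast hpow.le
  have hKlog : K * Real.log 2 ≤ Real.log n := by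
    rw [← Real.log_pow]
    exact Real.log_le_log (by positivity) hpow'
  have hK6 : (K : ℝ) + 2 ≤ 6 * Real.log n := by
    nlinarith [(Nat.cast_nonneg K : (0 : ℝ) ≤ K)]
  have hsq : ((K : ℝ) + 2) ^ 2 ≤ 36 * Real.log n ^ 2 := by
    have := pow_le_pow_left₀ (by positivity) hK6 2
    linarith
  have hlogsq : 1 / 4 ≤ Real.log n ^ 2 := by nlinarith
  have hmain : ((K : ℝ) + 2) ^ 2 * (2 ^ K * 2) ≤ 72 * (n * Real.log n ^ 2) := by
    have := mul_le_mul hsq (mul_le_mul_of_nonneg_right hpow' zero_le_two) (by positivity)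
      (by positivity)
    linarith
  have hlin : (n : ℝ) ≤ 4 * (n * Real.log n ^ 2) := by nlinarith
  have hnl : 0 ≤ (n : ℝ) * Real.log n ^ 2 := by positivity
  rw [Real.norm_of_nonneg (by positivity), Real.norm_of_nonneg (add_nonneg hnl (hf n)), hK,
    cauchyCost]
  rw [Real.norm_of_nonneg (by positivity), Real.norm_of_nonneg (hf n)] at hn
  have h1 : C * f n ≤ max C 5000000 * f n := mul_le_mul_of_nonneg_right (le_max_left _ _) (hf n)
  have h2 : 5000000 * ((n : ℝ) * Real.log n ^ 2) ≤ max C 5000000 * (n * Real.log n ^ 2) :=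
    mul_le_mul_of_nonneg_right (le_max_right _ _) hnl
  push_cast
  rw [pow_succ (2 : ℝ) K, add_assoc (K : ℝ) 1 1, one_add_one_eq_two, mul_add]
  linarith

/-- One program for all updates with `lam i ≠ mu j`. -/
theorem exists_uniform_program {n : ℕ} {U : Matrix (Fin n) (Fin n) ℝ} {t : ℕ}
    (hU : HasMatVecProgram U t) :
    ∃ P : RProgram (InputVec × Fin n) (Fin n),
      P.steps ≤ cauchyCost (Nat.clog 2 n) + 20 * n + 4 + (t + 1) ∧
      ∀ s lam mu z a : Fin n → ℝ, (∀ i j, lam i ≠ mu j) →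
        P.Outputs (packInputs s lam mu z a)
          ((U * (Matrix.diagonal z * cauchyMatrix lam mu * Matrix.diagonal a)).mulVec s) := by
  -- All admissible inputs form the index set of the function ring, so a single computation serves
  -- every `lam`, `mu`, `z`, `a` and `s`.
  let D := {x : InputVec × Fin n → ℝ // ∀ i j, x (.oldEig, i) ≠ x (.newEig, j)}
  have hn : n ≤ 2 ^ Nat.clog 2 n := Nat.le_pow_clog one_lt_two n
  have h1 := Comp.scaledCauchy (D := D) hn (fun i d => d.1 (.signal, i))
    (fun i d => d.1 (.oldEig, i)) (fun i d => d.1 (.newEig, i)) (fun i d => d.1 (.weight, i))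
    (fun i d => d.1 (.scale, i)) fun i j d => d.2 i j
  have h2 := h1.trans (hU.fastMul D _)
  obtain ⟨P, hP, hout⟩ := Comp.exists_program (κ := Fin n) (fun d : D => d.1) (h2.mono_left (by
    refine Set.union_subset (Set.union_subset (Set.union_subset (Set.union_subset ?_ ?_) ?_) ?_) ?_
    all_goals
      rintro _ ⟨i, rfl⟩
      exact ⟨_, rfl⟩))
  refine ⟨P, hP.trans (by omega), fun s lam mu z a h => ?_⟩
  have := hout ⟨packInputs s lam mu z a, h⟩
  rw [← Matrix.mulVec_mulVec]
  exact this

/-- `U n` is the unperturbed basis in dimension `n`, with an `O(f n)` matrix-vector product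
algorithm. First part: in the nondegenerate case one program per dimension serves all updates,
given only the setup vectors `lam`, `mu`, `z = Uᵀ v` and the column normalization `a` of the
Cauchy factorization. Second part: all updates, degenerate ones included. -/
theorem theorem2
    (U : ∀ n : ℕ, Matrix (Fin n) (Fin n) ℝ) (f : ℕ → ℝ) (hf : ∀ n, 0 ≤ f n)
    (hU : ∃ t : ℕ → ℕ,
      (fun n => (t n : ℝ)) =O[Filter.atTop] f ∧ ∀ n, HasMatVecProgram (U n) (t n)) :
    (∃ Q : ∀ n : ℕ, RProgram (InputVec × Fin n) (Fin n),
      (fun n => ((Q n).steps : ℝ)) =O[Filter.atTop]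
        (fun n : ℕ => (n : ℝ) * Real.log n ^ 2 + f n) ∧
      ∀ (n : ℕ) (L : Matrix (Fin n) (Fin n) ℝ) (lam v : Fin n → ℝ) (ρ : ℝ)
        (X : Matrix (Fin n) (Fin n) ℝ) (mu : Fin n → ℝ),
        IsEigenbasis L (U n) lam →
        IsEigenbasis (rankOneUpdate L v ρ) X mu →
        Function.Injective lam → ρ ≠ 0 → (∀ j, (U n).transpose.mulVec v j ≠ 0) →
        (∀ i j, lam i ≠ mu j) ∧
        ∃ a : Fin n → ℝ,
          X = U n * Matrix.diagonal ((U n).transpose.mulVec v) * cauchyMatrix lam mu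
                * Matrix.diagonal a ∧
          ∀ s : Fin n → ℝ,
            (Q n).Outputs (packInputs s lam mu ((U n).transpose.mulVec v) a) (X.mulVec s)) ∧
    (∃ t : ℕ → ℕ,
      (fun n => (t n : ℝ)) =O[Filter.atTop] (fun n : ℕ => (n : ℝ) * Real.log n ^ 2 + f n) ∧
      ∀ (n : ℕ) (L : Matrix (Fin n) (Fin n) ℝ) (lam v : Fin n → ℝ) (ρ : ℝ),
        IsEigenbasis L (U n) lam →
        (∀ (X : Matrix (Fin n) (Fin n) ℝ) (mu : Fin n → ℝ),
          IsEigenbasis (rankOneUpdate L v ρ) X mu →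
          Function.Injective lam ∨ Function.Injective mu →
          HasMatVecProgram X (t n)) ∧
        ∃ (X : Matrix (Fin n) (Fin n) ℝ) (mu : Fin n → ℝ),
          IsEigenbasis (rankOneUpdate L v ρ) X mu ∧ HasMatVecProgram X (t n)) := by
  obtain ⟨tU, htU, hprog⟩ := hU
  have hcost := isBigO_cost hf htU
  have hn : ∀ n, n ≤ 2 ^ Nat.clog 2 n := fun n => Nat.le_pow_clog one_lt_two n
  refine ⟨?_, _, hcost, fun n L lam v ρ hL => ⟨fun X mu hX hinj => ?_, ?_⟩⟩
  · choose Q hQ hout using fun n => exists_uniform_program (hprog n)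
    refine ⟨Q, (Asymptotics.IsBigO.of_bound' (Filter.Eventually.of_forall fun n => ?_)).trans hcost,
      fun n L lam v ρ X mu hL hX hlam hρ hz => ?_⟩
    · rw [Real.norm_of_nonneg (Nat.cast_nonneg _), Real.norm_of_nonneg (Nat.cast_nonneg _)]
      exact_mod_cast hQ n
    · have hY := hL.rankOneUpdate_diagonal hX
      have hne := hY.ne_of_weight_ne_zero hlam hρ hz
      have hXU : X = U n * ((U n).transpose * X) := by
        rw [← Matrix.mul_assoc, mul_transpose_of_orthogonal hL.1, one_mul]
      obtain ⟨a, ha⟩ : ∃ a, (U n).transpose * X = Matrix.diagonal ((U n).transpose.mulVec v) *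
        cauchyMatrix lam mu * Matrix.diagonal a := ⟨_, hY.eq_scaledCauchy hne⟩
      rw [ha] at hXU
      refine ⟨hne, a, by simpa only [Matrix.mul_assoc] using hXU, fun s => ?_⟩
      have := hout n s lam mu ((U n).transpose.mulVec v) a hne
      rwa [← hXU] at this
  · have hY := hL.rankOneUpdate_diagonal hX
    have hXU : X = U n * ((U n).transpose * X) := by
      rw [← Matrix.mul_assoc, mul_transpose_of_orthogonal hL.1, one_mul]
    rw [hXU]
    exact (((hprog n).fastMul.mul (hY.fastMul hinj (hn n))).mono (by omega)).hasMatVecProgram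
  · obtain ⟨Y, mu, hY, hfast⟩ :=
      exists_fastMul_rankOneUpdate_diagonal lam ((U n).transpose.mulVec v) ρ (hn n)
    exact ⟨U n * Y, mu, hL.rankOneUpdate_of_diagonal hY,
      ((hprog n).fastMul.mul hfast).hasMatVecProgram⟩
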